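/- **Setting.** Let $m\ge n$, let $\mathbb R^{m\times n}$ carry $\langle X,Y\rangle=\mathrm{tr}(X^TY)$ and the Frobenius norm $\|\cdot\|$, let $\sigma_1(X)\ge\dots\ge\sigma_n(X)\ge 0$ be the singular values of $X$ and $\sigma(X)=(\sigma_1(X),\dots,\sigma_n(X))$. For $x\in\mathbb R^n$ let $\mathscr D(x)\in\mathbb R^{m\times n}$ be the diagonal matrix with diagonal $x$, $E_i=\mathscr D(e_i)$, and $\mathcal M(X)=\{(U,V): U\in\mathbb R^{m\times m},V\in\mathbb R^{n\times n}\text{ orthogonal},\ X=U\mathscr D(\sigma(X))V^T\}$. $\partial$ denotes the Clarke subdifferential. Let $f:\mathbb R^{m\times n}\to[0,\infty)$ be convex and Lipschitz continuous with constant $L_f$, let $\lambda>0$ and $v>0$ with $vL_f<\lambda$, and let $$\mathcal F(X)=f(X)+\lambda\Phi(X),\qquad \Phi(X)=\sum_{i=1}^n\min\{1,\sigma_i(X)/v\},$$ be level bounded. Put $\theta_1(t)=0$, $\theta_2(t)=t/v-1$, $\mathcal D(t)=\{i\in\{1,2\}:\theta_i(t)=\max\{\theta_1(t),\theta_2(t)\}\}$,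 and $\Phi^d(X)=\sum_{i=1}^n\big(\sigma_i(X)/v-\theta_{d_i}(\sigma_i(X))\big)$ for $d\in\{1,2\}^n$. Let $d^X_i=1$ if $\sigma_i(X)<v$ and $d^X_i=2$ if $\sigma_i(X)\ge v$. **Lifted stationary point.** $X$ is a lifted stationary point of $\min\mathcal F$ if there are $d_i\in\mathcal D(\sigma_i(X))$, $i=1,\dots,n$, with $$\lambda\sum_{i=1}^n\theta_{d_i}'(\sigma_i(X))E_i\in\Big\{U^T GV+\tfrac{\lambda}{v}\mathscr D(s):\ (U,V)\in\mathcal M(X),\ G\in\partial f(X),\ s\in\partial\|\cdot\|_1(\sigma(X))\Big\}.$$ **Smoothing function.** Let $\bar\mu>0$ and let $\tilde f:\mathbb R^{m\times n}\times[0,\bar\mu]\to\mathbb R$ and constants $\kappa,\tilde L>0$ be such that for every $\mu\in(0,\bar\mu]$ the function $\tilde f(\cdot,\mu)$ is convex and continuously differentiable with $\tilde L\mu^{-1}$-Lipschitz gradient; $\tilde f(Z,\mu)\to f(X)$ as $Z\to X$, $\mu\downarrow0$, for every $X$; every limit of gradients $\nabla\tilde f(Z_j,\mu_j)$ along sequences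 $Z_j\to X$, $\mu_j\downarrow 0$ belongs to $\partial f(X)$; $|\tilde f(X,\mu_2)-\tilde f(X,\mu_1)|\le\kappa|\mu_1-\mu_2|$ for all $X$ and $\mu_1,\mu_2\in[0,\bar\mu]$; and $|\tilde f(X,\mu)-f(X)|\le\kappa\mu$ for all $X$ and $\mu\in(0,\bar\mu]$. **Algorithm (GIMSPG).** Let $\sigma\in(0,1)$, $\alpha>0$, and let $\alpha_k,\beta_k,h_k$ ($k\ge 0$) be parameters. Start with $X^{-1}=X^0$ and $\mu_{-1}=\mu_0\in(0,\bar\mu]$. For $k=0,1,2,\dots$ put $Y^k=X^k+\alpha_k(X^k-X^{k-1})$, $Z^k=X^k+\beta_k(X^k-X^{k-1})$ and $d^k=d^{X^k}$, and let $X^{k+1}$ be any global minimizer over $\mathbb R^{m\times n}$ of $$X\mapsto\langle X-Y^k,\nabla\tilde f(Z^k,\mu_k)\rangle+\tfrac12h_k\mu_k^{-1}\|X-Y^k\|^2+\lambda\Phi^{d^k}(X).$$ With $H_k=\tilde f(X^k,\mu_{k-1})+\lambda\Phi(X^k)+\kappa\mu_{k-1}+\tfrac{h_k\alpha_k}{2}\mu_k^{-1}\|X^k-X^{k-1}\|^2$,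 set $\mu_{k+1}=\mu_k$ if $H_{k+1}-H_k\le-\alpha\mu_k^2$, and $\mu_{k+1}=\mu_0/(k+1)^\sigma$ otherwise. (As $H_{k+1}$ itself contains $\mu_{k+1}$, this is a condition on the sequences: the test is evaluated at the value of $\mu_{k+1}$ that is actually taken.) **Parameter constraints.** For some $\varepsilon>0$ (equivalently, for all sufficiently small $\varepsilon>0$): $\{\alpha_k\}$ is nonincreasing with $\alpha_k\in\big[0,\frac{1-2^\sigma\varepsilon}{1+2^\sigma}\big)$, $\beta_k\in[0,1]$, $\{h_k\}$ is positive and nonincreasing, and for all $k$ $$h_k^{-1}\le\min\left\{\frac{1-\alpha_k-(\alpha_k+\varepsilon)\frac{\mu_k}{\mu_{k+1}}}{(1-\beta_k)\tilde L},\ \frac{\alpha_k}{\beta_k\tilde L}\right\},$$ where the two bounds are understood after multiplying out the denominators, i.e. as $(1-\beta_k)\tilde L\le h_k\big(1-\alpha_k-(\alpha_k+\varepsilon)\frac{\mu_k}{\mu_{k+1}}\big)$ and $\beta_k\tilde L\le h_k\alpha_k$. **Theorem.** Let $\{X^k\},\{\mu_k\}$ be infinite sequences generated by GIMSPG under the parameter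 constraints, and let $\mathcal N^s=\{k\in\mathbb N:\mu_{k+1}\ne\mu_k\}$. Then every accumulation point of $\{X^k:k\in\mathcal N^s\}$ (limit of a subsequence with indices in $\mathcal N^s$) is a lifted stationary point of $\min\mathcal F$. -/

import Mathlib

open Filter Topology

attribute [local instance] Matrix.frobeniusNormedAddCommGroup Matrix.frobeniusNormedSpace

noncomputable section

namespace GIMSPG

/-- Real `m × n` matrices; they carry the Frobenius norm throughout. -/
abbrev Mat (m n : ℕ) := Matrix (Fin m) (Fin n) ℝ

/-- The trace inner product `⟨X, Y⟩ = tr(Xᵀ Y)`. -/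
def frobInner {m n : ℕ} (X Y : Mat m n) : ℝ := (X.transpose * Y).trace

/-- The `m × n` diagonal matrix `𝒟(x)` generated by `x`. -/
def rectDiag (m : ℕ) {n : ℕ} (x : Fin n → ℝ) : Mat m n :=
  Matrix.of fun i j => if (i : ℕ) = (j : ℕ) then x j else 0

/-- The `i`-th largest singular value of `X` (indices start at `0`). -/
def sv {m n : ℕ} (X : Mat m n) (i : Fin n) : ℝ :=
  (Matrix.toEuclideanLin X).singularValues (i : ℕ)

/-- `(U, V) ∈ ℳ(X)`: `U`, `V` are orthogonal and `X = U 𝒟(σ(X)) Vᵀ`. -/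
def IsSVD {m n : ℕ} (X : Mat m n) (U : Mat m m) (V : Mat n n) : Prop :=
  U ∈ Matrix.orthogonalGroup (Fin m) ℝ ∧ V ∈ Matrix.orthogonalGroup (Fin n) ℝ ∧
    X = U * rectDiag m (sv X) * V.transpose

/-! ### Clarke subdifferentials -/

/-- Clarke's generalized directional derivative
`f°(x; h) = limsup_{y → x, t ↓ 0} (f (y + t h) - f y) / t`
(used for locally Lipschitz `f`, for which the quotient is locally bounded). -/
def clarkeDeriv {E : Type*} [AddCommGroup E] [Module ℝ E] [TopologicalSpace E]
    (f : E → ℝ) (x h : E) : ℝ :=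
  limsup (fun p : E × ℝ => (f (p.1 + p.2 • h) - f p.1) / p.2) (𝓝 x ×ˢ 𝓝[>] (0 : ℝ))

/-- The Clarke subdifferential of a function of a matrix, for the trace inner product. -/
def clarkeSubdiff {m n : ℕ} (f : Mat m n → ℝ) (X : Mat m n) : Set (Mat m n) :=
  {G | ∀ H, frobInner G H ≤ clarkeDeriv f X H}

/-- The Clarke subdifferential of a function of a vector. -/
def clarkeSubdiffVec {n : ℕ} (g : (Fin n → ℝ) → ℝ) (x : Fin n → ℝ) : Set (Fin n → ℝ) :=
  {s | ∀ h, dotProduct s h ≤ clarkeDeriv g x h}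

/-- The `ℓ₁` norm of a vector. -/
def l1 {n : ℕ} (x : Fin n → ℝ) : ℝ := ∑ i, |x i|

/-! ### The capped-`ℓ₁` relaxation -/

/-- `θ₁(t) = 0` (index `0`) and `θ₂(t) = t / v - 1` (index `1`). -/
def theta (v : ℝ) (i : Fin 2) (t : ℝ) : ℝ := if i = 0 then 0 else t / v - 1

/-- `𝒟(t)`, the set of indices at which the maximum of `θ₁(t)`, `θ₂(t)` is attained. -/
def activePieces (v t : ℝ) : Set (Fin 2) :=
  {i | theta v i t = max (theta v 0 t) (theta v 1 t)}

/-- `Φ(X) = ∑ᵢ min {1, σᵢ(X) / v}`. -/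
def Phi {m n : ℕ} (v : ℝ) (X : Mat m n) : ℝ := ∑ i, min 1 (sv X i / v)

/-- `Φᵈ(X) = ∑ᵢ (σᵢ(X) / v - θ_{dᵢ}(σᵢ(X)))`. -/
def PhiD {m n : ℕ} (v : ℝ) (d : Fin n → Fin 2) (X : Mat m n) : ℝ :=
  ∑ i, (sv X i / v - theta v (d i) (sv X i))

/-- `d^X`: the first piece where `σᵢ(X) < v`, the second one where `σᵢ(X) ≥ v`. -/
def dOf {m n : ℕ} (v : ℝ) (X : Mat m n) : Fin n → Fin 2 :=
  fun i => if sv X i < v then 0 else 1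

/-- `X` is a lifted stationary point of `min f + lam * Φ`. -/
def IsLiftedStationary {m n : ℕ} (f : Mat m n → ℝ) (lam v : ℝ) (X : Mat m n) : Prop :=
  ∃ d : Fin n → Fin 2, (∀ i, d i ∈ activePieces v (sv X i)) ∧
    ∃ (U : Mat m m) (V : Mat n n), IsSVD X U V ∧
      ∃ G ∈ clarkeSubdiff f X, ∃ s ∈ clarkeSubdiffVec l1 (sv X),
        lam • ∑ i, deriv (theta v (d i)) (sv X i) • rectDiag m (Pi.single i (1 : ℝ)) =
          U.transpose * G * V + (lam / v) • rectDiag m s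

/-! ### Smoothing functions -/

/-- The gradient for the trace inner product: the matrix of partial derivatives. -/
def grad {m n : ℕ} (g : Mat m n → ℝ) (X : Mat m n) : Mat m n :=
  Matrix.of fun i j => fderiv ℝ g X (Matrix.single i j 1)

/-- `ft : ℝ^{m × n} × [0, mubar] → ℝ` is a smoothing function of `f`, with the constants `kappa`
and `Lt`. Values `ft X mu` with `mu` outside `[0, mubar]` play no role. -/
structure IsSmoothing {m n : ℕ} (f : Mat m n → ℝ) (ft : Mat m n → ℝ → ℝ)
    (mubar kappa Lt : ℝ) : Prop where
  mubar_pos : 0 < mubar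
  kappa_pos : 0 < kappa
  Lt_pos : 0 < Lt
  contDiff : ∀ mu ∈ Set.Ioc 0 mubar, ContDiff ℝ 1 fun X => ft X mu
  tendsto : ∀ X, Tendsto (fun p : Mat m n × ℝ => ft p.1 p.2) (𝓝 X ×ˢ 𝓝[>] (0 : ℝ)) (𝓝 (f X))
  convex : ∀ mu ∈ Set.Ioc 0 mubar, ConvexOn ℝ Set.univ fun X => ft X mu
  grad_consistent : ∀ (X G : Mat m n) (Z : ℕ → Mat m n) (mu : ℕ → ℝ),
    Tendsto Z atTop (𝓝 X) → (∀ j, mu j ∈ Set.Ioc 0 mubar) → Tendsto mu atTop (𝓝 0) →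
    Tendsto (fun j => grad (fun Y => ft Y (mu j)) (Z j)) atTop (𝓝 G) → G ∈ clarkeSubdiff f X
  lipschitz_mu : ∀ X, ∀ mu₁ ∈ Set.Icc 0 mubar, ∀ mu₂ ∈ Set.Icc 0 mubar,
    |ft X mu₂ - ft X mu₁| ≤ kappa * |mu₁ - mu₂|
  approx : ∀ X, ∀ mu ∈ Set.Ioc 0 mubar, |ft X mu - f X| ≤ kappa * mu
  lipschitz_grad : ∀ mu ∈ Set.Ioc 0 mubar, ∀ X Y,
    ‖grad (fun W => ft W mu) X - grad (fun W => ft W mu) Y‖ ≤ Lt * mu⁻¹ * ‖X - Y‖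

/-! ### The algorithm -/

/-- The entry with index `k - 1`, where the entry with index `-1` equals the one with index `0`. -/
def prev {A : Type*} (x : ℕ → A) : ℕ → A
  | 0 => x 0
  | k + 1 => x k

/-- `x^k + c (x^k - x^{k-1})`. -/
def extrapolate {m n : ℕ} (X : ℕ → Mat m n) (c : ℝ) (k : ℕ) : Mat m n :=
  X k + c • (X k - prev X k)

/-- The objective `Q_d(X, Y, Z, mu)` of the subproblem, with parameter `h`. -/
def Q {m n : ℕ} (ft : Mat m n → ℝ → ℝ) (lam v h : ℝ) (d : Fin n → Fin 2)
    (X Y Z : Mat m n) (mu : ℝ) : ℝ :=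
  frobInner (X - Y) (grad (fun W => ft W mu) Z) + 1 / 2 * (h * mu⁻¹) * ‖X - Y‖ ^ 2
    + lam * PhiD v d X

/-- `Hseq … k` is `H_{δ_k}(X^k, X^{k-1}, μ_k, μ_{k-1})`
`= ft(X^k, μ_{k-1}) + lam Φ(X^k) + kappa μ_{k-1} + δ_k μ_k⁻¹ ‖X^k - X^{k-1}‖²`
with `δ_k = h_k α_k / 2`. -/
def Hseq {m n : ℕ} (ft : Mat m n → ℝ → ℝ) (lam v kappa : ℝ) (α h : ℕ → ℝ)
    (X : ℕ → Mat m n) (mu : ℕ → ℝ) (k : ℕ) : ℝ :=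
  ft (X k) (prev mu k) + lam * Phi v (X k) + kappa * prev mu k
    + h k * α k / 2 * (mu k)⁻¹ * ‖X k - prev X k‖ ^ 2

/-- The constraints on the parameters. The two upper bounds
`h_k⁻¹ ≤ (1 - α_k - (α_k + ε) μ_k / μ_{k+1}) / ((1 - β_k) Lt)` and `h_k⁻¹ ≤ α_k / (β_k Lt)`
are written without denominators, since `β_k = 1` and `β_k = 0` are allowed. -/
structure ParameterConstraints (sigma Lt ε : ℝ) (α β h mu : ℕ → ℝ) : Prop where
  eps_pos : 0 < ε
  alpha_antitone : Antitone α
  alpha_nonneg : ∀ k, 0 ≤ α k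
  alpha_lt : ∀ k, α k < (1 - 2 ^ sigma * ε) / (1 + 2 ^ sigma)
  beta_mem : ∀ k, β k ∈ Set.Icc (0 : ℝ) 1
  h_pos : ∀ k, 0 < h k
  h_antitone : Antitone h
  h_bound₁ : ∀ k, (1 - β k) * Lt ≤ h k * (1 - α k - (α k + ε) * (mu k / mu (k + 1)))
  h_bound₂ : ∀ k, β k * Lt ≤ h k * α k

/-- `X`, `mu` are infinite sequences generated by the algorithm (without termination), where
`a` is the positive constant of the decrease test and `sigma` the exponent of the update. -/
structure IsRun {m n : ℕ} (ft : Mat m n → ℝ → ℝ) (lam v mubar kappa sigma a : ℝ)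
    (α β h : ℕ → ℝ) (X : ℕ → Mat m n) (mu : ℕ → ℝ) : Prop where
  mu_zero : mu 0 ∈ Set.Ioc 0 mubar
  step : ∀ k, ∀ W : Mat m n,
    Q ft lam v (h k) (dOf v (X k)) (X (k + 1))
        (extrapolate X (α k) k) (extrapolate X (β k) k) (mu k) ≤
      Q ft lam v (h k) (dOf v (X k)) W
        (extrapolate X (α k) k) (extrapolate X (β k) k) (mu k)
  keep : ∀ k, Hseq ft lam v kappa α h X mu (k + 1) - Hseq ft lam v kappa α h X mu k
      ≤ -a * mu k ^ 2 → mu (k + 1) = mu k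
  shrink : ∀ k, ¬ (Hseq ft lam v kappa α h X mu (k + 1) - Hseq ft lam v kappa α h X mu k
      ≤ -a * mu k ^ 2) → mu (k + 1) = mu 0 / ((k : ℝ) + 1) ^ sigma

/-- `𝒩ˢ = {k : μ_{k+1} ≠ μ_k}`. -/
def Ns (mu : ℕ → ℝ) : Set ℕ := {k | mu (k + 1) ≠ mu k}

end GIMSPG

end

/-! An index `k` lies in 𝒩ˢ only if the decrease test failed there: H_{k+1} - H_k > -a μ_k². On the
other hand `Hseq_succ_add_le` shows that every step lowers H by at least h_k ε ‖X^{k+1} - X^k‖² / (2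
μ_{k+1}). Together they force ‖X^{k+1} - X^k‖ = o(μ_k) along 𝒩ˢ.

The increment X^k - X^{k-1} needs another argument, as k - 1 need not lie in 𝒩ˢ. H_k itself contains
(h_k α_k / 2) μ_k⁻¹ ‖X^k - X^{k-1}‖², and the failed test bounds H_k by H_{k+1} + a μ_k². Since
f̃(·, μ_k) and Φ are Lipschitz, what remains is o(μ_k), so h_k α_k ‖X^k - X^{k-1}‖ / μ_k → 0
(`tendsto_inertial_div`). Hence X^{k+1} and Z^k have the same limit as X^k, and the proximal term
(h_k / μ_k)(X^{k+1} - Y^k) vanishes.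

It remains to pass to the limit in the optimality condition of the subproblem. Φᵈ is not convex in
general, so `exists_svd_of_isMin` works with test matrices. Those with the singular values of
X^{k+1} show that the gradient residual is diagonal in some SVD of X^{k+1}; diagonal perturbations
then give scalar inequalities for its entries. Both facts survive limits, since orthogonal factors,
gradients and active pieces range over compact or finite sets. The matrix input is von Neumann's
trace inequality, proved here by linear programming duality. -/

namespace GIMSPG

/-! ### Trace inner product, orthogonal conjugation and rectangular diagonal matrices -/

section FrobeniusInner

variable {m n : ℕ}

lemma frobInner_eq_sum (X Y : Mat m n) : frobInner X Y = ∑ i, ∑ j, X i j * Y i j := by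
  simp only [frobInner, Matrix.trace, Matrix.diag_apply, Matrix.mul_apply, Matrix.transpose_apply]
  exact Finset.sum_comm

lemma frobInner_comm (X Y : Mat m n) : frobInner X Y = frobInner Y X := by
  simp [frobInner_eq_sum, mul_comm]

lemma frobInner_add_left (X Y Z : Mat m n) :
    frobInner (X + Y) Z = frobInner X Z + frobInner Y Z := by
  simp [frobInner, Matrix.add_mul]

lemma frobInner_add_right (X Y Z : Mat m n) :
    frobInner X (Y + Z) = frobInner X Y + frobInner X Z := by
  simp [frobInner, Matrix.mul_add]

lemma frobInner_sub_left (X Y Z : Mat m n) :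
    frobInner (X - Y) Z = frobInner X Z - frobInner Y Z := by
  simp [frobInner, Matrix.sub_mul]

lemma frobInner_sub_right (X Y Z : Mat m n) :
    frobInner X (Y - Z) = frobInner X Y - frobInner X Z := by
  simp [frobInner, Matrix.mul_sub]

lemma frobInner_smul_left (c : ℝ) (X Y : Mat m n) :
    frobInner (c • X) Y = c * frobInner X Y := by
  simp [frobInner]

lemma frobInner_smul_right (c : ℝ) (X Y : Mat m n) :
    frobInner X (c • Y) = c * frobInner X Y := by
  simp [frobInner]

lemma norm_sq_eq_frobInner (X : Mat m n) : ‖X‖ ^ 2 = frobInner X X := by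
  rw [Matrix.frobenius_norm_def, ← Real.sqrt_eq_rpow, Real.sq_sqrt (by positivity),
    frobInner_eq_sum]
  simp [pow_two]

lemma norm_add_sq_frob (X Y : Mat m n) :
    ‖X + Y‖ ^ 2 = ‖X‖ ^ 2 + 2 * frobInner X Y + ‖Y‖ ^ 2 := by
  simp only [norm_sq_eq_frobInner, frobInner_add_left, frobInner_add_right, frobInner_comm Y X]
  ring

lemma norm_sub_sq_frob (X Y : Mat m n) :
    ‖X - Y‖ ^ 2 = ‖X‖ ^ 2 - 2 * frobInner X Y + ‖Y‖ ^ 2 := by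
  simp only [norm_sq_eq_frobInner, frobInner_sub_left, frobInner_sub_right, frobInner_comm Y X]
  ring

lemma frobInner_le_norm_mul_norm (X Y : Mat m n) : frobInner X Y ≤ ‖X‖ * ‖Y‖ := by
  refine le_of_sq_le_sq ?_ (by positivity)
  rw [mul_pow, norm_sq_eq_frobInner, norm_sq_eq_frobInner]
  simp only [frobInner_eq_sum, ← Fintype.sum_prod_type', ← pow_two]
  exact Finset.sum_mul_sq_le_sq_mul_sq _ _ _

lemma frobInner_conj_left (U : Mat m m) (V : Mat n n) (A B : Mat m n) :
    frobInner (U * A * V.transpose) B = frobInner A (U.transpose * B * V) := by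
  simp only [frobInner, Matrix.transpose_mul, Matrix.transpose_transpose, Matrix.mul_assoc]
  rw [Matrix.trace_mul_comm]
  simp only [Matrix.mul_assoc]

lemma transpose_mul_self_of_orthogonal {k : ℕ} {U : Mat k k}
    (hU : U ∈ Matrix.orthogonalGroup (Fin k) ℝ) : U.transpose * U = 1 :=
  Matrix.mem_orthogonalGroup_iff' (Fin k) ℝ |>.1 hU

lemma mul_transpose_self_of_orthogonal {k : ℕ} {U : Mat k k}
    (hU : U ∈ Matrix.orthogonalGroup (Fin k) ℝ) : U * U.transpose = 1 :=
  Matrix.mem_orthogonalGroup_iff (Fin k) ℝ |>.1 hU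

lemma transpose_mem_orthogonal {k : ℕ} {U : Mat k k}
    (hU : U ∈ Matrix.orthogonalGroup (Fin k) ℝ) :
    U.transpose ∈ Matrix.orthogonalGroup (Fin k) ℝ := by
  rw [Matrix.mem_orthogonalGroup_iff']
  exact (congrArg _ rfl).trans (mul_transpose_self_of_orthogonal hU)

lemma conj_transpose_conj {U : Mat m m} {V : Mat n n}
    (hU : U ∈ Matrix.orthogonalGroup (Fin m) ℝ) (hV : V ∈ Matrix.orthogonalGroup (Fin n) ℝ)
    (A : Mat m n) : U.transpose * (U * A * V.transpose) * V = A := by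
  calc _ = (U.transpose * U) * A * (V.transpose * V) := by simp only [Matrix.mul_assoc]
    _ = A := by
      rw [transpose_mul_self_of_orthogonal hU, transpose_mul_self_of_orthogonal hV]; simp

lemma frobInner_conj_conj {U : Mat m m} {V : Mat n n}
    (hU : U ∈ Matrix.orthogonalGroup (Fin m) ℝ) (hV : V ∈ Matrix.orthogonalGroup (Fin n) ℝ)
    (A B : Mat m n) :
    frobInner (U * A * V.transpose) (U * B * V.transpose) = frobInner A B := by
  rw [frobInner_conj_left, conj_transpose_conj hU hV]

lemma rectDiag_add (x y : Fin n → ℝ) : rectDiag m (x + y) = rectDiag m x + rectDiag m y := by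
  ext i j; simp only [rectDiag, Matrix.of_apply, Matrix.add_apply, Pi.add_apply]; split_ifs <;> simp

lemma rectDiag_sub (x y : Fin n → ℝ) : rectDiag m (x - y) = rectDiag m x - rectDiag m y := by
  ext i j; simp only [rectDiag, Matrix.of_apply, Matrix.sub_apply, Pi.sub_apply]; split_ifs <;> simp

lemma rectDiag_smul (c : ℝ) (x : Fin n → ℝ) : rectDiag m (c • x) = c • rectDiag m x := by
  ext i j; simp only [rectDiag, Matrix.of_apply, Matrix.smul_apply, Pi.smul_apply]
  split_ifs <;> simp

lemma rectDiag_sum_single (c : Fin n → ℝ) :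
    ∑ i, c i • rectDiag m (Pi.single i (1 : ℝ)) = rectDiag m c := by
  ext i j
  simp only [Matrix.sum_apply, rectDiag, Matrix.of_apply, Matrix.smul_apply, smul_eq_mul]
  split_ifs <;> simp [Pi.single_apply]

lemma frobInner_rectDiag_left (hmn : n ≤ m) (x : Fin n → ℝ) (B : Mat m n) :
    frobInner (rectDiag m x) B = ∑ j, x j * B (Fin.castLE hmn j) j := by
  rw [frobInner_eq_sum, Finset.sum_comm]
  refine Finset.sum_congr rfl fun j _ => ?_
  rw [Finset.sum_eq_single (Fin.castLE hmn j)]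
  · simp [rectDiag]
  · intro i _ hi
    have : (i : ℕ) ≠ j := fun h => hi (Fin.ext (by simpa using h))
    simp [rectDiag, this]
  · simp

lemma frobInner_rectDiag (hmn : n ≤ m) (x y : Fin n → ℝ) :
    frobInner (rectDiag m x) (rectDiag m y) = ∑ j, x j * y j := by
  rw [frobInner_rectDiag_left hmn]
  simp [rectDiag]

lemma continuous_rectDiag : Continuous (rectDiag m (n := n)) := by
  refine continuous_matrix fun i j => ?_
  simp only [rectDiag, Matrix.of_apply]
  split_ifs <;> fun_prop

end FrobeniusInner

/-! ### Von Neumann's trace inequality by dual potentials -/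

section VonNeumann

/-- Dual potentials for the assignment problem with sorted product costs. -/
lemma exists_dual_potentials_nat (n : ℕ) {a b : ℕ → ℝ} (ha : Antitone a) (hb : Antitone b)
    (ha0 : ∀ i, 0 ≤ a i) (hbn : b n = 0) :
    ∃ u w : ℕ → ℝ, (∀ i ≤ n, 0 ≤ u i) ∧ (∀ i ≤ n, 0 ≤ w i) ∧ (∀ i, u i + w i = a i * b i) ∧
      ∀ i j, a i * b j ≤ u i + w j := by
  -- For `k ≤ n` this is the tail sum of `a l * (b l - b (l + 1))` over `k ≤ l < n`; the other
  -- potential is then forced by `u i + w i = a i * b i`.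
  set w : ℕ → ℝ := fun k => ∑ l ∈ Finset.range n, a l * (b l - b (l + 1))
    - ∑ l ∈ Finset.range k, a l * (b l - b (l + 1)) with hw
  have hstep : ∀ k, w (k + 1) = w k - a k * (b k - b (k + 1)) := fun k => by
    simp only [hw, Finset.sum_range_succ]; ring
  have hdec : ∀ k, b (k + 1) ≤ b k := fun k => hb k.le_succ
  have hw_anti : Antitone w := antitone_nat_of_succ_le fun k => by
    rw [hstep]; nlinarith [ha0 k, hdec k]
  have hwn : w n = 0 := sub_self _
  -- For fixed `i`, the sequence `j ↦ w j - a i * b j` has increments `(a i - a j) * (b j - b (j +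
  -- 1))`: nonpositive before `i`, nonnegative from `i` on. So its minimum is at `j = i`. Taking `j
  -- = n` gives `0 ≤ u i`.
  have hmin : ∀ i j, w i - a i * b i ≤ w j - a i * b j := by
    intro i j
    rcases le_total i j with hij | hij
    · induction j, hij using Nat.le_induction with
      | base => exact le_rfl
      | succ j hij ih =>
        rw [hstep]
        nlinarith [mul_nonneg (sub_nonneg.2 (ha hij)) (sub_nonneg.2 (hdec j))]
    · induction hij using Nat.decreasingInduction with
      | self => exact le_rfl
      | of_succ j hij ih =>
        rw [hstep] at ih
        nlinarith [mul_nonneg (sub_nonneg.2 (ha hij.le)) (sub_nonneg.2 (hdec j))]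
  refine ⟨fun i => a i * b i - w i, w, fun i _ => ?_, fun i hi => hwn ▸ hw_anti hi,
    fun i => by ring, fun i j => ?_⟩
  · have := hmin i n
    rw [hwn, hbn] at this
    linarith
  · linarith [hmin i j]

/-- Extension of a finite sequence by zeros. -/
def extendZero {n : ℕ} (a : Fin n → ℝ) (k : ℕ) : ℝ := if h : k < n then a ⟨k, h⟩ else 0

lemma extendZero_val {n : ℕ} (a : Fin n → ℝ) (i : Fin n) : extendZero a i = a i := by
  simp [extendZero]

lemma extendZero_nonneg {n : ℕ} {a : Fin n → ℝ} (ha : ∀ i, 0 ≤ a i) (k : ℕ) :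
    0 ≤ extendZero a k := by
  unfold extendZero; split_ifs <;> simp [ha]

lemma extendZero_antitone {n : ℕ} {a : Fin n → ℝ} (ha : Antitone a) (ha0 : ∀ i, 0 ≤ a i) :
    Antitone (extendZero a) := by
  intro i j hij
  by_cases hj : j < n
  · simpa [extendZero, hj, hij.trans_lt hj] using ha (by simpa using hij)
  · simpa [extendZero, hj] using extendZero_nonneg ha0 i

lemma exists_dual_potentials {n : ℕ} {a b : Fin n → ℝ} (ha : Antitone a) (hb : Antitone b)
    (ha0 : ∀ i, 0 ≤ a i) (hb0 : ∀ i, 0 ≤ b i) :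
    ∃ u w : Fin n → ℝ, (∀ i, 0 ≤ u i) ∧ (∀ i, 0 ≤ w i) ∧ (∀ i, u i + w i = a i * b i) ∧
      ∀ i j, a i * b j ≤ u i + w j := by
  obtain ⟨u, w, hu, hw, huw, hle⟩ := exists_dual_potentials_nat n (extendZero_antitone ha ha0)
    (extendZero_antitone hb hb0) (extendZero_nonneg ha0) (by simp [extendZero])
  refine ⟨fun i => u i, fun i => w i, fun i => hu i i.2.le, fun i => hw i i.2.le,
    fun i => ?_, fun i j => ?_⟩
  · simpa only [extendZero_val] using huw i
  · simpa only [extendZero_val] using hle i j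

variable {m n : ℕ}

lemma sum_sq_row_of_orthogonal {k : ℕ} {P : Mat k k}
    (hP : P ∈ Matrix.orthogonalGroup (Fin k) ℝ) (i : Fin k) : ∑ j, P i j ^ 2 = 1 := by
  have := congrFun (congrFun (mul_transpose_self_of_orthogonal hP) i) i
  simpa [Matrix.mul_apply, pow_two] using this

lemma sum_sq_col_of_orthogonal {k : ℕ} {P : Mat k k}
    (hP : P ∈ Matrix.orthogonalGroup (Fin k) ℝ) (j : Fin k) : ∑ i, P i j ^ 2 = 1 :=
  sum_sq_row_of_orthogonal (transpose_mem_orthogonal hP) j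

lemma sum_castLE_le (hmn : n ≤ m) {g : Fin m → ℝ} (hg : ∀ i, 0 ≤ g i) :
    ∑ j, g (Fin.castLE hmn j) ≤ ∑ i, g i := by
  refine (Finset.sum_map Finset.univ (Fin.castLEEmb hmn) g).symm.le.trans ?_
  exact Finset.sum_le_sum_of_subset_of_nonneg (Finset.subset_univ _) fun i _ _ => hg i

/-- The inner product is a bilinear sum with weights `P * R`, which are dominated by a doubly
substochastic matrix; summing the dual inequality against that matrix gives the bound. Rows of the
`n × n` block of `P` may have norm below one, hence the need for nonnegative potentials. -/
lemma frobInner_rectDiag_conj_le (hmn : n ≤ m) {P : Mat m m} {R : Mat n n}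
    (hP : P ∈ Matrix.orthogonalGroup (Fin m) ℝ) (hR : R ∈ Matrix.orthogonalGroup (Fin n) ℝ)
    {a b u w : Fin n → ℝ} (hu : ∀ i, 0 ≤ u i) (hw : ∀ i, 0 ≤ w i)
    (hle : ∀ i j, |a i| * |b j| ≤ u i + w j) :
    frobInner (rectDiag m a) (P * rectDiag m b * R.transpose) ≤ ∑ i, (u i + w i) := by
  set e := Fin.castLE hmn
  have hentry : ∀ i, (P * rectDiag m b * R.transpose) (e i) i = ∑ j, P (e i) (e j) * b j * R i j := by
    intro i
    rw [Matrix.mul_apply]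
    refine Finset.sum_congr rfl fun j _ => ?_
    rw [Matrix.mul_apply, Finset.sum_eq_single (e j)]
    · simp [rectDiag, e]
    · intro l _ hl
      have : (l : ℕ) ≠ j := fun h => hl (Fin.ext (by simpa [e] using h))
      simp [rectDiag, this]
    · simp
  set S : Fin n → Fin n → ℝ := fun i j => (P (e i) (e j) ^ 2 + R i j ^ 2) / 2 with hS
  have hS0 : ∀ i j, 0 ≤ S i j := fun i j => by positivity
  have hrow : ∀ i, ∑ j, S i j ≤ 1 := fun i => by
    have h1 := sum_castLE_le hmn (g := fun j => P (e i) j ^ 2) fun j => sq_nonneg _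
    have h2 := sum_sq_row_of_orthogonal hP (e i)
    have h3 := sum_sq_row_of_orthogonal hR i
    simp only [hS, ← Finset.sum_div, Finset.sum_add_distrib]
    linarith
  have hcol : ∀ j, ∑ i, S i j ≤ 1 := fun j => by
    have h1 := sum_castLE_le hmn (g := fun i => P i (e j) ^ 2) fun j => sq_nonneg _
    have h2 := sum_sq_col_of_orthogonal hP (e j)
    have h3 := sum_sq_col_of_orthogonal hR j
    simp only [hS, ← Finset.sum_div, Finset.sum_add_distrib]
    linarith
  calc frobInner (rectDiag m a) (P * rectDiag m b * R.transpose)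
      = ∑ i, ∑ j, a i * (P (e i) (e j) * b j * R i j) := by
        rw [frobInner_rectDiag_left hmn]
        exact Finset.sum_congr rfl fun i _ => by rw [hentry, Finset.mul_sum]
    _ ≤ ∑ i, ∑ j, (u i * S i j + w j * S i j) := by
        refine Finset.sum_le_sum fun i _ => Finset.sum_le_sum fun j _ => ?_
        calc a i * (P (e i) (e j) * b j * R i j)
            ≤ |a i * (P (e i) (e j) * b j * R i j)| := le_abs_self _
          _ = |a i| * |b j| * (|P (e i) (e j)| * |R i j|) := by simp only [abs_mul]; ring
          _ ≤ |a i| * |b j| * S i j := by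
            refine mul_le_mul_of_nonneg_left ?_ (by positivity)
            have := sq_nonneg (|P (e i) (e j)| - |R i j|)
            simp only [hS]
            nlinarith [sq_abs (P (e i) (e j)), sq_abs (R i j)]
          _ ≤ (u i + w j) * S i j := mul_le_mul_of_nonneg_right (hle i j) (hS0 i j)
          _ = _ := by ring
    _ = ∑ i, u i * ∑ j, S i j + ∑ j, w j * ∑ i, S i j := by
        simp only [Finset.sum_add_distrib, Finset.mul_sum]
        rw [Finset.sum_comm (f := fun i j => w j * S i j)]
    _ ≤ ∑ i, u i + ∑ j, w j := add_le_add
        (Finset.sum_le_sum fun i _ => mul_le_of_le_one_right (hu i) (hrow i))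
        (Finset.sum_le_sum fun i _ => mul_le_of_le_one_right (hw i) (hcol i))
    _ = _ := Finset.sum_add_distrib.symm

lemma frobInner_conj_rectDiag_le (hmn : n ≤ m) {U U' : Mat m m} {V V' : Mat n n}
    (hU : U ∈ Matrix.orthogonalGroup (Fin m) ℝ) (hV : V ∈ Matrix.orthogonalGroup (Fin n) ℝ)
    (hU' : U' ∈ Matrix.orthogonalGroup (Fin m) ℝ) (hV' : V' ∈ Matrix.orthogonalGroup (Fin n) ℝ)
    {a b u w : Fin n → ℝ} (hu : ∀ i, 0 ≤ u i) (hw : ∀ i, 0 ≤ w i)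
    (hle : ∀ i j, |a i| * |b j| ≤ u i + w j) :
    frobInner (U * rectDiag m a * V.transpose) (U' * rectDiag m b * V'.transpose)
      ≤ ∑ i, (u i + w i) := by
  rw [frobInner_conj_left]
  have := frobInner_rectDiag_conj_le hmn (mul_mem (transpose_mem_orthogonal hU) hU')
    (mul_mem (transpose_mem_orthogonal hV) hV') hu hw hle
  simpa only [Matrix.transpose_mul, Matrix.transpose_transpose, Matrix.mul_assoc] using this

/-- Von Neumann's trace inequality. -/
lemma frobInner_conj_rectDiag_le_sum_mul (hmn : n ≤ m) {U U' : Mat m m} {V V' : Mat n n}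
    (hU : U ∈ Matrix.orthogonalGroup (Fin m) ℝ) (hV : V ∈ Matrix.orthogonalGroup (Fin n) ℝ)
    (hU' : U' ∈ Matrix.orthogonalGroup (Fin m) ℝ) (hV' : V' ∈ Matrix.orthogonalGroup (Fin n) ℝ)
    {a b a' b' : Fin n → ℝ} (ha : Antitone a') (hb : Antitone b')
    (haa : ∀ i, |a i| ≤ a' i) (hbb : ∀ i, |b i| ≤ b' i) :
    frobInner (U * rectDiag m a * V.transpose) (U' * rectDiag m b * V'.transpose)
      ≤ ∑ i, a' i * b' i := by
  obtain ⟨u, w, hu, hw, huw, hle⟩ := exists_dual_potentials ha hb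
    (fun i => (abs_nonneg _).trans (haa i)) (fun i => (abs_nonneg _).trans (hbb i))
  simp only [← huw]
  exact frobInner_conj_rectDiag_le hmn hU hV hU' hV' hu hw fun i j =>
    (mul_le_mul (haa i) (hbb j) (abs_nonneg _) ((abs_nonneg _).trans (haa i))).trans (hle i j)

end VonNeumann

/-! ### Singular value decomposition and its consequences -/

section SingularValues

variable {m n : ℕ}

lemma sv_nonneg (X : Mat m n) (i : Fin n) : 0 ≤ sv X i := LinearMap.singularValues_nonneg _ _

lemma sv_antitone (X : Mat m n) : Antitone (sv X) := fun _ _ h =>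
  LinearMap.singularValues_antitone _ h

lemma ofBasis_mem_orthogonal {k : ℕ}
    (u : OrthonormalBasis (Fin k) ℝ (EuclideanSpace ℝ (Fin k))) :
    Matrix.of (fun i j => u j i) ∈ Matrix.orthogonalGroup (Fin k) ℝ := by
  rw [Matrix.mem_orthogonalGroup_iff']
  ext i j
  have := orthonormal_iff_ite.1 u.orthonormal j i
  simp only [PiLp.inner_apply, RCLike.inner_apply, conj_trivial] at this
  rw [Matrix.mul_apply, Matrix.one_apply]
  simpa [Matrix.star_apply, eq_comm] using this

/-- Existence of a singular value decomposition. -/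
lemma exists_isSVD (hmn : n ≤ m) (X : Mat m n) : ∃ U V, IsSVD X U V := by
  set T := Matrix.toEuclideanLin X with hT
  have hfin : Module.finrank ℝ (EuclideanSpace ℝ (Fin n)) = n := finrank_euclideanSpace_fin
  set b := T.isSymmetric_adjoint_comp_self.eigenvectorBasis hfin with hb
  have hinner : ∀ i j, inner ℝ (T (b i)) (T (b j)) = if i = j then sv X j ^ 2 else 0 := by
    intro i j
    rw [← LinearMap.adjoint_inner_right, ← LinearMap.comp_apply,
      LinearMap.IsSymmetric.apply_eigenvectorBasis, inner_smul_right,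
      orthonormal_iff_ite.1 b.orthonormal i j, ← LinearMap.sq_singularValues_fin]
    split_ifs <;> simp [sv, hT]
  set e := Fin.castLE hmn with he
  -- Normalised images of the eigenvectors. Only the slots in `s`, where the singular value is
  -- nonzero, have to be orthonormal; the zeros elsewhere are discarded when a basis is completed.
  set w : Fin m → EuclideanSpace ℝ (Fin m) := fun j =>
    if h : (j : ℕ) < n then (sv X ⟨j, h⟩)⁻¹ • T (b ⟨j, h⟩) else 0 with hw
  have hwe : ∀ i, w (e i) = (sv X i)⁻¹ • T (b i) := fun i => by simp [hw, he]
  set s : Set (Fin m) := {j | ∃ i, e i = j ∧ sv X i ≠ 0} with hs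
  have horth : Orthonormal ℝ (s.domRestrict w) := by
    rw [orthonormal_iff_ite]
    rintro ⟨_, i, rfl, hi⟩ ⟨_, j, rfl, hj⟩
    change inner ℝ (w (e i)) (w (e j)) = _
    simp only [hwe, inner_smul_left, inner_smul_right, hinner, Subtype.mk.injEq,
      conj_trivial]
    by_cases hij : i = j
    · subst hij
      simp only [if_true]
      field_simp
    · have : e i ≠ e j := fun h => hij (Fin.castLE_injective hmn h)
      simp [hij, this]
  obtain ⟨u, hu⟩ := horth.exists_orthonormalBasis_extension_of_card_eq (by simp)
  have hTb : ∀ i, T (b i) = sv X i • u (e i) := by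
    intro i
    by_cases hi : sv X i = 0
    · have := hinner i i
      rw [if_pos rfl, hi, zero_pow two_ne_zero, inner_self_eq_zero] at this
      rw [this, hi, zero_smul]
    · rw [hu _ ⟨i, rfl, hi⟩, hwe, smul_smul, mul_inv_cancel₀ hi, one_smul]
  refine ⟨Matrix.of fun i j => u j i, Matrix.of fun i j => b j i, ofBasis_mem_orthogonal u,
    ofBasis_mem_orthogonal b, ?_⟩
  have hXV : X * Matrix.of (fun i j => b j i)
      = Matrix.of (fun i j => u j i) * rectDiag m (sv X) := by
    ext i j
    have h1 := congrArg (fun y => y i) (hTb j)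
    simp only [hT, Matrix.toLpLin_apply, PiLp.smul_apply, smul_eq_mul] at h1
    rw [Matrix.mul_apply, Matrix.mul_apply, Finset.sum_eq_single (e j)]
    · simpa [Matrix.mulVec, dotProduct, rectDiag, he, mul_comm] using h1
    · intro l _ hl
      have : (l : ℕ) ≠ j := fun h => hl (Fin.ext (by simpa [he] using h))
      simp [rectDiag, this]
    · simp
  rw [← hXV, Matrix.mul_assoc, mul_transpose_self_of_orthogonal (ofBasis_mem_orthogonal b),
    Matrix.mul_one]

lemma abs_sv (X : Mat m n) (i : Fin n) : |sv X i| = sv X i := abs_of_nonneg (sv_nonneg X i)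

lemma frobInner_le_sum_sv_mul (hmn : n ≤ m) (A B : Mat m n) :
    frobInner A B ≤ ∑ i, sv A i * sv B i := by
  obtain ⟨U, V, hU, hV, hA⟩ := exists_isSVD hmn A
  obtain ⟨U', V', hU', hV', hB⟩ := exists_isSVD hmn B
  conv_lhs => rw [hA, hB]
  exact frobInner_conj_rectDiag_le_sum_mul hmn hU hV hU' hV' (sv_antitone A) (sv_antitone B)
    (fun i => (abs_sv A i).le) (fun i => (abs_sv B i).le)

lemma norm_sq_eq_sum_sv_sq (hmn : n ≤ m) (A : Mat m n) : ‖A‖ ^ 2 = ∑ i, sv A i ^ 2 := by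
  obtain ⟨U, V, hU, hV, hA⟩ := exists_isSVD hmn A
  rw [norm_sq_eq_frobInner]
  conv_lhs => rw [hA, frobInner_conj_conj hU hV, frobInner_rectDiag hmn]
  simp [pow_two]

/-- Both squared norms are sums of squared singular values, so this is the trace inequality after
expanding the squares. -/
lemma sum_sv_sub_sq_le (hmn : n ≤ m) (A B : Mat m n) :
    ∑ i, (sv A i - sv B i) ^ 2 ≤ ‖A - B‖ ^ 2 := by
  rw [norm_sub_sq_frob, norm_sq_eq_sum_sv_sq hmn A, norm_sq_eq_sum_sv_sq hmn B]
  have := frobInner_le_sum_sv_mul hmn A B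
  have h2 : ∑ i, (sv A i - sv B i) ^ 2
      = ∑ i, sv A i ^ 2 - 2 * ∑ i, sv A i * sv B i + ∑ i, sv B i ^ 2 := by
    rw [Finset.mul_sum, ← Finset.sum_sub_distrib, ← Finset.sum_add_distrib]
    exact Finset.sum_congr rfl fun i _ => by ring
  linarith

lemma abs_sv_sub_le (hmn : n ≤ m) (A B : Mat m n) (i : Fin n) : |sv A i - sv B i| ≤ ‖A - B‖ := by
  refine abs_le_of_sq_le_sq ?_ (norm_nonneg _)
  exact (Finset.single_le_sum (f := fun i => (sv A i - sv B i) ^ 2) (fun i _ => sq_nonneg _)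
    (Finset.mem_univ i)).trans (sum_sv_sub_sq_le hmn A B)

lemma continuous_sv (hmn : n ≤ m) (i : Fin n) : Continuous fun A : Mat m n => sv A i := by
  have : LipschitzWith 1 fun A : Mat m n => sv A i := LipschitzWith.of_dist_le_mul fun A B => by
    simpa [dist_eq_norm] using abs_sv_sub_le hmn A B i
  exact this.continuous

/-- Singular values are determined by any decomposition with sorted nonnegative diagonal. -/
lemma sv_conj_rectDiag (hmn : n ≤ m) {U : Mat m m} {V : Mat n n}
    (hU : U ∈ Matrix.orthogonalGroup (Fin m) ℝ) (hV : V ∈ Matrix.orthogonalGroup (Fin n) ℝ)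
    {a : Fin n → ℝ} (ha : Antitone a) (ha0 : ∀ i, 0 ≤ a i) :
    sv (U * rectDiag m a * V.transpose) = a := by
  set A := U * rectDiag m a * V.transpose with hAdef
  obtain ⟨U', V', hU', hV', hA⟩ := exists_isSVD hmn A
  have h1 : ‖A‖ ^ 2 = ∑ i, a i ^ 2 := by
    rw [norm_sq_eq_frobInner, hAdef, frobInner_conj_conj hU hV, frobInner_rectDiag hmn]
    simp [pow_two]
  -- Since `a` and `sv A` both have sum of squares `‖A‖ ^ 2`, this bound makes them equal.
  have h2 : ‖A‖ ^ 2 ≤ ∑ i, a i * sv A i := by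
    rw [norm_sq_eq_frobInner]
    calc frobInner A A = frobInner (U * rectDiag m a * V.transpose)
          (U' * rectDiag m (sv A) * V'.transpose) := by rw [← hA]
      _ ≤ _ := frobInner_conj_rectDiag_le_sum_mul hmn hU hV hU' hV' ha (sv_antitone A)
        (fun i => (abs_of_nonneg (ha0 i)).le) (fun i => (abs_sv A i).le)
  have h3 := norm_sq_eq_sum_sv_sq hmn A
  have h4 : ∑ i, (sv A i - a i) ^ 2 = 0 := by
    refine le_antisymm ?_ (Finset.sum_nonneg fun i _ => sq_nonneg _)
    have : ∑ i, (sv A i - a i) ^ 2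
        = ∑ i, sv A i ^ 2 - 2 * ∑ i, a i * sv A i + ∑ i, a i ^ 2 := by
      rw [Finset.mul_sum, ← Finset.sum_sub_distrib, ← Finset.sum_add_distrib]
      exact Finset.sum_congr rfl fun i _ => by ring
    linarith
  ext i
  have := (Finset.sum_eq_zero_iff_of_nonneg fun i _ => sq_nonneg _).1 h4 i (Finset.mem_univ i)
  exact sub_eq_zero.1 (pow_eq_zero_iff two_ne_zero |>.1 this)

/-- The nuclear norm is a pairing with a matrix all of whose singular values are one. The potentials
`|z i|` and `0` serve here, so `z` need not be sorted. -/
lemma sum_sv_conj_rectDiag_le (hmn : n ≤ m) {U : Mat m m} {V : Mat n n}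
    (hU : U ∈ Matrix.orthogonalGroup (Fin m) ℝ) (hV : V ∈ Matrix.orthogonalGroup (Fin n) ℝ)
    (z : Fin n → ℝ) : ∑ i, sv (U * rectDiag m z * V.transpose) i ≤ ∑ i, |z i| := by
  set A := U * rectDiag m z * V.transpose with hAdef
  obtain ⟨U', V', hU', hV', hA⟩ := exists_isSVD hmn A
  calc ∑ i, sv A i = frobInner (U' * rectDiag m (sv A) * V'.transpose)
        (U' * rectDiag m (fun _ : Fin n => (1 : ℝ)) * V'.transpose) := by
        rw [frobInner_conj_conj hU' hV', frobInner_rectDiag hmn]; simp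
    _ = frobInner (U * rectDiag m z * V.transpose)
        (U' * rectDiag m (fun _ : Fin n => (1 : ℝ)) * V'.transpose) := by rw [← hA]
    _ ≤ ∑ i, (|z i| + 0) := frobInner_conj_rectDiag_le hmn hU hV hU' hV'
        (fun i => abs_nonneg _) (fun i => le_rfl) (fun i j => by simp)
    _ = _ := by simp

/-- The left side is a pairing with the diagonal `b i * sign (z i)`, dominated in modulus by the
sorted `b`. This controls the part of Φᵈ that enters with a minus sign. -/
lemma sum_mul_abs_le_sum_mul_sv (hmn : n ≤ m) {U : Mat m m} {V : Mat n n}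
    (hU : U ∈ Matrix.orthogonalGroup (Fin m) ℝ) (hV : V ∈ Matrix.orthogonalGroup (Fin n) ℝ)
    (z : Fin n → ℝ) {b : Fin n → ℝ} (hb : Antitone b) (hb0 : ∀ i, 0 ≤ b i) :
    ∑ i, b i * |z i| ≤ ∑ i, b i * sv (U * rectDiag m z * V.transpose) i := by
  set A := U * rectDiag m z * V.transpose with hAdef
  obtain ⟨U', V', hU', hV', hA⟩ := exists_isSVD hmn A
  calc ∑ i, b i * |z i| = frobInner (U * rectDiag m (fun i => b i * SignType.sign (z i)) *
        V.transpose) (U * rectDiag m z * V.transpose) := by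
        rw [frobInner_conj_conj hU hV, frobInner_rectDiag hmn]
        exact Finset.sum_congr rfl fun i _ => by rw [mul_assoc, sign_mul_self]
    _ = frobInner (U * rectDiag m (fun i => b i * SignType.sign (z i)) * V.transpose)
        (U' * rectDiag m (sv A) * V'.transpose) := by rw [← hA]
    _ ≤ _ := frobInner_conj_rectDiag_le_sum_mul hmn hU hV hU' hV' hb (sv_antitone A)
        (fun i => ?_) (fun i => (abs_sv A i).le)
  rw [abs_mul, abs_of_nonneg (hb0 i)]
  refine mul_le_of_le_one_right (hb0 i) ?_
  rcases lt_trichotomy (z i) 0 with h | h | h <;> simp [h]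

/-- A matrix that maximises `⟨·, M⟩` among the matrices with the same singular values is
diagonalised simultaneously with `M`. -/
lemma exists_simultaneous_svd (hmn : n ≤ m) {X M : Mat m n}
    (hmax : ∀ W : Mat m n, sv W = sv X → frobInner W M ≤ frobInner X M) :
    ∃ U V, IsSVD X U V ∧ ∃ y : Fin n → ℝ, M = U * rectDiag m y * V.transpose := by
  -- Decomposing `M + X` instead of `M` avoids the equality case of the trace inequality: the extra
  -- `⟨·, X⟩` is strictly maximised at `X` among matrices of the same norm, so the competitor `X'`
  -- must equal `X`.
  obtain ⟨U, V, hU, hV, hMX⟩ := exists_isSVD hmn (M + X)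
  set X' := U * rectDiag m (sv X) * V.transpose with hX'
  have hsv : sv X' = sv X := sv_conj_rectDiag hmn hU hV (sv_antitone X) (sv_nonneg X)
  have hle : frobInner X (M + X) ≤ frobInner X' (M + X) := by
    refine (frobInner_le_sum_sv_mul hmn X (M + X)).trans (le_of_eq ?_)
    conv_rhs => rw [hMX, hX', frobInner_conj_conj hU hV, frobInner_rectDiag hmn]
  have hnorm : ‖X'‖ ^ 2 = ‖X‖ ^ 2 := by
    rw [norm_sq_eq_sum_sv_sq hmn, norm_sq_eq_sum_sv_sq hmn, hsv]
  have hXX : X = X' := by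
    have h1 := hmax X' hsv
    rw [frobInner_add_right, frobInner_add_right, ← norm_sq_eq_frobInner] at hle
    have h2 : ‖X - X'‖ ^ 2 ≤ 0 := by
      rw [norm_sub_sq_frob, hnorm, frobInner_comm X X']; linarith
    exact sub_eq_zero.1 (norm_eq_zero.1 (pow_eq_zero_iff two_ne_zero |>.1
      (le_antisymm h2 (sq_nonneg _))))
  refine ⟨U, V, ⟨hU, hV, hXX⟩, sv (M + X) - sv X, ?_⟩
  rw [rectDiag_sub, Matrix.mul_sub, Matrix.sub_mul, ← hMX, ← hX', ← hXX, add_sub_cancel_right]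

end SingularValues

/-! ### The capped penalty Φ and its majorants Φᵈ -/

section Relaxation

variable {m n : ℕ}

/-- The indicator of the coordinates at which `d` selects the piece `θ₂`. -/
noncomputable def pieceInd (d : Fin n → Fin 2) (i : Fin n) : ℝ := if d i = 0 then 0 else 1

lemma pieceInd_nonneg (d : Fin n → Fin 2) (i : Fin n) : 0 ≤ pieceInd d i := by
  unfold pieceInd; split_ifs <;> norm_num

lemma pieceInd_le_one (d : Fin n → Fin 2) (i : Fin n) : pieceInd d i ≤ 1 := by
  unfold pieceInd; split_ifs <;> norm_num

lemma theta_eq (v : ℝ) (d : Fin n → Fin 2) (i : Fin n) (t : ℝ) :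
    theta v (d i) t = pieceInd d i * (t / v - 1) := by
  unfold theta pieceInd; split_ifs <;> simp

/-- Singular values decrease, so those at least `v` form an initial segment. This ordering is what
lets the trace inequality handle Φᵈ. -/
lemma pieceInd_dOf_antitone (v : ℝ) (X : Mat m n) : Antitone (pieceInd (dOf v X)) := by
  intro i j hij
  have := sv_antitone X hij
  simp only [pieceInd, dOf]
  split_ifs <;> simp_all
  linarith

lemma PhiD_eq (v : ℝ) (d : Fin n → Fin 2) (X : Mat m n) :
    PhiD v d X = (∑ i, sv X i - ∑ i, pieceInd d i * sv X i) / v + ∑ i, pieceInd d i := by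
  rw [← Finset.sum_sub_distrib, Finset.sum_div, ← Finset.sum_add_distrib]
  exact Finset.sum_congr rfl fun i _ => by rw [theta_eq]; ring

/-- A perturbed diagonal need not stay sorted or nonnegative. The nuclear norm is bounded above and
the subtracted partial sum below, so Φᵈ can be estimated as if the entries `|z i|` kept their
places. -/
lemma PhiD_conj_rectDiag_le (hmn : n ≤ m) {v : ℝ} (hv : 0 < v) {d : Fin n → Fin 2}
    (hd : Antitone (pieceInd d)) {U : Mat m m} {V : Mat n n}
    (hU : U ∈ Matrix.orthogonalGroup (Fin m) ℝ) (hV : V ∈ Matrix.orthogonalGroup (Fin n) ℝ)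
    (z : Fin n → ℝ) :
    PhiD v d (U * rectDiag m z * V.transpose)
      ≤ (∑ i, |z i| - ∑ i, pieceInd d i * |z i|) / v + ∑ i, pieceInd d i := by
  rw [PhiD_eq]
  have h1 := sum_sv_conj_rectDiag_le hmn hU hV z
  have h2 := sum_mul_abs_le_sum_mul_sv hmn hU hV z hd (pieceInd_nonneg d)
  gcongr

/-- The choice `d^X` attains the maximum of θ₁, θ₂ at each singular value, so the majorant of
`Phi_le_PhiD` touches Φ at `X`. -/
lemma PhiD_dOf {v : ℝ} (hv : 0 < v) (X : Mat m n) : PhiD v (dOf v X) X = Phi v X := by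
  refine Finset.sum_congr rfl fun i _ => ?_
  unfold dOf theta
  split_ifs with h1 h2 h2
  · rw [min_eq_right ((div_le_one hv).2 h1.le)]; ring
  · simp at h2
  · simp at h2
  · rw [min_eq_left ((one_le_div hv).2 (not_lt.1 h1))]; ring

lemma Phi_le_PhiD (v : ℝ) (d : Fin n → Fin 2) (X : Mat m n) : Phi v X ≤ PhiD v d X := by
  refine Finset.sum_le_sum fun i _ => ?_
  unfold theta
  split_ifs
  · simp
  · simp

lemma Phi_sub_le (hmn : n ≤ m) {v : ℝ} (hv : 0 < v) (A B : Mat m n) :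
    Phi v A - Phi v B ≤ n / v * ‖A - B‖ := by
  rw [Phi, Phi, ← Finset.sum_sub_distrib]
  calc _ ≤ ∑ _i : Fin n, ‖A - B‖ / v := Finset.sum_le_sum fun i _ => ?_
    _ = _ := by simp; ring
  have h := (abs_le.1 (abs_sv_sub_le hmn A B i)).2
  have h2 : sv A i / v ≤ sv B i / v + ‖A - B‖ / v := by
    rw [← add_div]; gcongr; linarith
  have h3 : 0 ≤ ‖A - B‖ / v := by positivity
  rw [sub_le_iff_le_add]
  rcases min_cases 1 (sv B i / v) with ⟨h4, _⟩ | ⟨h4, _⟩ <;> rw [h4]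
  · exact (min_le_left _ _).trans (by linarith)
  · exact (min_le_right _ _).trans (by linarith)

end Relaxation

/-! ### Optimality condition of the subproblem -/

section Subproblem

variable {m n : ℕ}

lemma nonneg_of_forall_mul_add_sq_mul {A B : ℝ}
    (h : ∀ t : ℝ, 0 < t → t ≤ 1 → 0 ≤ t * A + t ^ 2 * B) : 0 ≤ A := by
  have hlim : Tendsto (fun t : ℝ => A + t * B) (𝓝[>] 0) (𝓝 A) := by
    have : Tendsto (fun t : ℝ => A + t * B) (𝓝 0) (𝓝 (A + 0 * B)) :=
      Continuous.tendsto (by fun_prop) 0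
    simpa using this.mono_left nhdsWithin_le_nhds
  refine ge_of_tendsto hlim ?_
  filter_upwards [Ioc_mem_nhdsGT (zero_lt_one' ℝ)] with t ht
  have := h t ht.1 ht.2
  have h2 : 0 ≤ t * (A + t * B) := by linarith
  exact nonneg_of_mul_nonneg_right h2 ht.1

/-- Optimality condition at a global minimiser of the subproblem. -/
lemma exists_svd_of_isMin (hmn : n ≤ m) {lam v c : ℝ} (hlam : 0 < lam) (hv : 0 < v)
    {d : Fin n → Fin 2} (hd : Antitone (pieceInd d)) {X Y g : Mat m n}
    (hmin : ∀ W : Mat m n, frobInner (X - Y) g + 1 / 2 * c * ‖X - Y‖ ^ 2 + lam * PhiD v d X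
      ≤ frobInner (W - Y) g + 1 / 2 * c * ‖W - Y‖ ^ 2 + lam * PhiD v d W) :
    ∃ U V, IsSVD X U V ∧ ∃ ρ : Fin n → ℝ, U.transpose * (g + c • (X - Y)) * V = rectDiag m ρ ∧
      ∀ i η, 0 ≤ ρ i * η + lam / v * (1 - pieceInd d i) * (|sv X i + η| - sv X i) := by
  set R := g + c • (X - Y) with hR
  -- The smooth part is quadratic, so its expansion at `X` is exact and has gradient `R` there.
  have hkey : ∀ W : Mat m n, 0 ≤ frobInner (W - X) R + c / 2 * ‖W - X‖ ^ 2
      + lam * (PhiD v d W - PhiD v d X) := by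
    intro W
    have h1 : W - Y = (W - X) + (X - Y) := by abel
    have h2 := hmin W
    rw [h1, norm_add_sq_frob, frobInner_add_left] at h2
    rw [hR, frobInner_add_right, frobInner_smul_right]
    linarith
  -- Competitors with the singular values of `X` change neither Φᵈ nor the norm, so only linear
  -- terms survive.
  have hmax : ∀ W : Mat m n, sv W = sv X → frobInner W (c • X - R) ≤ frobInner X (c • X - R) := by
    intro W hW
    have h1 := hkey W
    have h2 : PhiD v d W = PhiD v d X := by simp only [PhiD, hW]
    have h3 : ‖W‖ ^ 2 = ‖X‖ ^ 2 := by
      rw [norm_sq_eq_sum_sv_sq hmn, norm_sq_eq_sum_sv_sq hmn, hW]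
    rw [h2, norm_sub_sq_frob, h3, frobInner_sub_left] at h1
    rw [frobInner_sub_right, frobInner_sub_right, frobInner_smul_right, frobInner_smul_right,
      ← norm_sq_eq_frobInner]
    linarith
  obtain ⟨U, V, hsvd, y, hy⟩ := exists_simultaneous_svd hmn hmax
  obtain ⟨hU, hV, hX⟩ := hsvd
  set ρ : Fin n → ℝ := c • sv X - y with hρ
  have hRρ : R = U * rectDiag m ρ * V.transpose := by
    rw [hρ, rectDiag_sub, rectDiag_smul, Matrix.mul_sub, Matrix.sub_mul, ← hy, Matrix.mul_smul,
      Matrix.smul_mul, ← hX, sub_sub_cancel]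
  refine ⟨U, V, ⟨hU, hV, hX⟩, ρ, by rw [hRρ, conj_transpose_conj hU hV], fun i η => ?_⟩
  refine nonneg_of_forall_mul_add_sq_mul (B := c / 2 * η ^ 2) fun t ht ht1 => ?_
  set z : Fin n → ℝ := sv X + Pi.single i (t * η) with hz
  set W := U * rectDiag m z * V.transpose with hW
  have hWX : W - X = U * rectDiag m (Pi.single i (t * η)) * V.transpose := by
    rw [hW, hz, rectDiag_add, Matrix.mul_add, Matrix.add_mul, ← hX, add_sub_cancel_left]
  have h1 : frobInner (W - X) R = t * η * ρ i := by
    rw [hWX, hRρ, frobInner_conj_conj hU hV, frobInner_rectDiag hmn]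
    simp [Pi.single_apply]
  have h2 : ‖W - X‖ ^ 2 = t ^ 2 * η ^ 2 := by
    rw [norm_sq_eq_frobInner, hWX, frobInner_conj_conj hU hV, frobInner_rectDiag hmn]
    simp [Pi.single_apply]; ring
  have h3 : PhiD v d W - PhiD v d X
      ≤ (1 - pieceInd d i) * (t * (|sv X i + η| - sv X i)) / v := by
    have h4 := PhiD_conj_rectDiag_le hmn hv hd hU hV z
    rw [← hW] at h4
    have h5 : (∑ j, |z j| - ∑ j, pieceInd d j * |z j|)
        - (∑ j, sv X j - ∑ j, pieceInd d j * sv X j)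
        = (1 - pieceInd d i) * (|sv X i + t * η| - sv X i) := by
      rw [← Finset.sum_sub_distrib, ← Finset.sum_sub_distrib, ← Finset.sum_sub_distrib,
        Finset.sum_eq_single i]
      · simp [hz]; ring
      · intro j _ hj
        simp [hz, hj, abs_sv]
      · simp
    -- Convexity of the absolute value replaces the step `t * η` by `t` times the full step `η`. The
    -- resulting condition involves no derivative, so it is stable under limits.
    have h6 : |sv X i + t * η| - sv X i ≤ t * (|sv X i + η| - sv X i) := by
      have : sv X i + t * η = (1 - t) * sv X i + t * (sv X i + η) := by ring
      rw [this]
      refine (sub_le_sub_right (abs_add_le _ _) _).trans ?_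
      rw [abs_mul, abs_mul, abs_of_nonneg (sub_nonneg.2 ht1), abs_of_pos ht, abs_sv]
      linarith
    rw [PhiD_eq v d X]
    calc _ ≤ ((∑ j, |z j| - ∑ j, pieceInd d j * |z j|)
          - (∑ j, sv X j - ∑ j, pieceInd d j * sv X j)) / v := by
            simp only [sub_div] at h4 ⊢; linarith
      _ ≤ _ := by
        rw [h5]
        have := pieceInd_le_one d i
        gcongr
  have h7 := hkey W
  rw [h1, h2] at h7
  have h8 := mul_le_mul_of_nonneg_left h3 hlam.le
  calc 0 ≤ _ := h7
    _ ≤ t * η * ρ i + c / 2 * (t ^ 2 * η ^ 2)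
      + lam * ((1 - pieceInd d i) * (t * (|sv X i + η| - sv X i)) / v) := by linarith
    _ = _ := by ring

end Subproblem

/-! ### Gradient inequalities and Lipschitz bounds for the smoothing function -/

section Gradient

variable {m n : ℕ}

lemma fderiv_eq_frobInner_grad (g : Mat m n → ℝ) (Z H : Mat m n) :
    fderiv ℝ g Z H = frobInner (grad g Z) H := by
  conv_lhs => rw [Matrix.matrix_eq_sum_single H]
  simp only [map_sum, frobInner_eq_sum]
  refine Finset.sum_congr rfl fun i _ => Finset.sum_congr rfl fun j _ => ?_
  have : Matrix.single i j (H i j) = H i j • Matrix.single i j (1 : ℝ) := by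
    rw [Matrix.smul_single, smul_eq_mul, mul_one]
  rw [this, map_smul, smul_eq_mul, mul_comm]
  rfl

lemma hasDerivAt_comp_line {g : Mat m n → ℝ} (hg : Differentiable ℝ g) (Z D : Mat m n) (t : ℝ) :
    HasDerivAt (fun t : ℝ => g (Z + t • D)) (frobInner (grad g (Z + t • D)) D) t := by
  rw [← fderiv_eq_frobInner_grad]
  have h : HasDerivAt (fun t : ℝ => Z + t • D) D t := by
    have := ((hasDerivAt_id t).smul_const D).const_add Z
    rwa [one_smul] at this
  exact (hg _).hasFDerivAt.comp_hasDerivAt t h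

lemma add_frobInner_grad_le {g : Mat m n → ℝ} (hg : Differentiable ℝ g)
    (hc : ConvexOn ℝ Set.univ g) (Z D : Mat m n) : g Z + frobInner (grad g Z) D ≤ g (Z + D) := by
  have hc' : ConvexOn ℝ Set.univ fun t : ℝ => g (Z + t • D) := by
    have := hc.comp_affineMap (AffineMap.lineMap Z (Z + D))
    rw [Set.preimage_univ] at this
    refine this.congr fun t _ => ?_
    simp [AffineMap.lineMap_apply, add_comm]
  have h := hasDerivAt_comp_line hg Z D 0
  have := hc'.le_slope_of_hasDerivAt (Set.mem_univ 0) (Set.mem_univ 1) one_pos h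
  simp [slope_def_field] at this
  linarith

/-- The descent lemma. -/
lemma le_add_frobInner_grad_add {g : Mat m n → ℝ} (hg : Differentiable ℝ g) {L : ℝ}
    (hL : ∀ X Y, ‖grad g X - grad g Y‖ ≤ L * ‖X - Y‖) (Z D : Mat m n) :
    g (Z + D) ≤ g Z + frobInner (grad g Z) D + L / 2 * ‖D‖ ^ 2 := by
  set φ : ℝ → ℝ := fun t =>
    g (Z + t • D) - (t * frobInner (grad g Z) D + L / 2 * ‖D‖ ^ 2 * t ^ 2) with hφ
  have hder : ∀ t, HasDerivAt φ (frobInner (grad g (Z + t • D)) D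
      - (1 * frobInner (grad g Z) D + L / 2 * ‖D‖ ^ 2 * (2 * t))) t := fun t => by
    have h1 := ((hasDerivAt_id t).mul_const (frobInner (grad g Z) D)).add
      ((hasDerivAt_pow 2 t).const_mul (L / 2 * ‖D‖ ^ 2))
    exact ((hasDerivAt_comp_line hg Z D t).sub h1).congr_deriv (by simp)
  have hanti : AntitoneOn φ (Set.Ici 0) := by
    refine antitoneOn_of_deriv_nonpos (convex_Ici 0)
      (fun t _ => (hder t).continuousAt.continuousWithinAt)
      (fun t _ => (hder t).differentiableAt.differentiableWithinAt) fun t ht => ?_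
    rw [interior_Ici, Set.mem_Ioi] at ht
    rw [(hder t).deriv]
    have h1 := (frobInner_le_norm_mul_norm (grad g (Z + t • D) - grad g Z) D).trans
      (mul_le_mul_of_nonneg_right (hL (Z + t • D) Z) (norm_nonneg D))
    rw [add_sub_cancel_left, norm_smul, Real.norm_of_nonneg ht.le, frobInner_sub_left] at h1
    linarith
  have := hanti (Set.mem_Ici.2 le_rfl) (Set.mem_Ici.2 zero_le_one) zero_le_one
  simp only [hφ, one_smul, zero_smul, add_zero] at this
  linarith

lemma le_of_forall_mul_le_mul_add {A B C : ℝ} (h : ∀ t : ℝ, 0 < t → t * A ≤ t * B + C) :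
    A ≤ B := by
  by_contra hAB
  have hpos : 0 < A - B := sub_pos.2 (not_le.1 hAB)
  have h1 := h ((|C| + 1) / (A - B)) (by positivity)
  have h2 : (|C| + 1) / (A - B) * (A - B) = |C| + 1 := div_mul_cancel₀ _ hpos.ne'
  linarith [le_abs_self C]

/-- Along the ray `Z + t • D` convexity bounds `t` times the slope by the growth of the smoothing
function, which differs from that of `f` by at most `2 * (kappa * mu)`. Letting `t → ∞` removes this
error, and the constant of `f` is kept. -/
lemma IsSmoothing.frobInner_grad_le {f : Mat m n → ℝ} {ft : Mat m n → ℝ → ℝ}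
    {mubar kappa Lt : ℝ} (hft : IsSmoothing f ft mubar kappa Lt) {Lf : NNReal}
    (hf : LipschitzWith Lf f) {mu : ℝ} (hmu : mu ∈ Set.Ioc 0 mubar) (Z D : Mat m n) :
    frobInner (grad (fun X => ft X mu) Z) D ≤ Lf * ‖D‖ := by
  refine le_of_forall_mul_le_mul_add (C := 2 * (kappa * mu)) fun t ht => ?_
  have h1 := add_frobInner_grad_le ((hft.contDiff mu hmu).differentiable one_ne_zero)
    (hft.convex mu hmu) Z (t • D)
  have h2 := abs_le.1 (hft.approx Z mu hmu)
  have h3 := abs_le.1 (hft.approx (Z + t • D) mu hmu)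
  have h4 := (abs_le.1 (hf.dist_le_mul (Z + t • D) Z)).2
  rw [dist_eq_norm, add_sub_cancel_left, norm_smul, Real.norm_of_nonneg ht.le] at h4
  rw [frobInner_smul_right] at h1
  linarith

lemma IsSmoothing.norm_grad_le {f : Mat m n → ℝ} {ft : Mat m n → ℝ → ℝ}
    {mubar kappa Lt : ℝ} (hft : IsSmoothing f ft mubar kappa Lt) {Lf : NNReal}
    (hf : LipschitzWith Lf f) {mu : ℝ} (hmu : mu ∈ Set.Ioc 0 mubar) (Z : Mat m n) :
    ‖grad (fun X => ft X mu) Z‖ ≤ Lf := by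
  have h := hft.frobInner_grad_le hf hmu Z (grad (fun X => ft X mu) Z)
  rw [← norm_sq_eq_frobInner, pow_two] at h
  by_contra hlt
  have hlt := not_le.1 hlt
  exact absurd h (not_le.2 (mul_lt_mul_of_pos_right hlt (Lf.coe_nonneg.trans_lt hlt)))

lemma IsSmoothing.ft_sub_le {f : Mat m n → ℝ} {ft : Mat m n → ℝ → ℝ}
    {mubar kappa Lt : ℝ} (hft : IsSmoothing f ft mubar kappa Lt) {Lf : NNReal}
    (hf : LipschitzWith Lf f) {mu : ℝ} (hmu : mu ∈ Set.Ioc 0 mubar) (A B : Mat m n) :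
    ft A mu - ft B mu ≤ Lf * ‖A - B‖ := by
  have h1 := add_frobInner_grad_le ((hft.contDiff mu hmu).differentiable one_ne_zero)
    (hft.convex mu hmu) A (B - A)
  rw [add_sub_cancel] at h1
  have h2 := hft.frobInner_grad_le hf hmu A (A - B)
  rw [frobInner_sub_right] at h1 h2
  linarith

end Gradient

/-! ### Clarke subgradients of the ℓ₁ norm -/

section Clarke

variable {n : ℕ}

lemma l1_add_sub_le (y h : Fin n → ℝ) : l1 (y + h) - l1 y ≤ l1 h := by
  rw [l1, l1, l1, sub_le_iff_le_add', ← Finset.sum_add_distrib]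
  exact Finset.sum_le_sum fun i _ => abs_add_le _ _

lemma mem_clarkeSubdiffVec_l1 {x s : Fin n → ℝ} (hs : ∀ i η, s i * η ≤ |x i + η| - |x i|) :
    s ∈ clarkeSubdiffVec l1 x := by
  intro h
  have hbdd : ∀ᶠ p : (Fin n → ℝ) × ℝ in 𝓝 x ×ˢ 𝓝[>] (0 : ℝ),
      (l1 (p.1 + p.2 • h) - l1 p.1) / p.2 ≤ l1 h := by
    have : ∀ᶠ p : (Fin n → ℝ) × ℝ in 𝓝 x ×ˢ 𝓝[>] (0 : ℝ), 0 < p.2 :=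
      tendsto_snd.eventually self_mem_nhdsWithin
    filter_upwards [this] with p hp
    rw [div_le_iff₀ hp]
    refine (l1_add_sub_le _ _).trans (le_of_eq ?_)
    simp [l1, abs_mul, abs_of_pos hp, ← Finset.mul_sum, mul_comm]
  -- Fixing the base point at `x` already gives enough quotients for a lower bound on the limsup;
  -- the upper bound `hbdd` keeps this real limsup meaningful.
  refine le_limsup_of_frequently_le ?_ (isBoundedUnder_of_eventually_le hbdd)
  have hle : (pure x : Filter (Fin n → ℝ)) ×ˢ 𝓝[>] (0 : ℝ) ≤ 𝓝 x ×ˢ 𝓝[>] (0 : ℝ) :=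
    prod_mono (pure_le_nhds x) le_rfl
  refine Frequently.filter_mono ?_ hle
  rw [pure_prod, frequently_map]
  refine Eventually.frequently ?_
  filter_upwards [self_mem_nhdsWithin] with t ht
  rw [le_div_iff₀ ht, l1, l1, ← Finset.sum_sub_distrib, dotProduct, Finset.sum_mul]
  refine Finset.sum_le_sum fun i _ => ?_
  have := hs i (t * h i)
  simp only [Pi.add_apply, Pi.smul_apply, smul_eq_mul]
  linarith

end Clarke

/-! ### Monotonicity and limit of the smoothing parameters -/

section Smoothing

variable {m n : ℕ} {ft : Mat m n → ℝ → ℝ} {lam v mubar kappa sigma a : ℝ} {α β h : ℕ → ℝ}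
  {X : ℕ → Mat m n} {mu : ℕ → ℝ}

lemma IsRun.mu_succ_eq (hrun : IsRun ft lam v mubar kappa sigma a α β h X mu) (k : ℕ) :
    mu (k + 1) = mu k ∨ mu (k + 1) = mu 0 / ((k : ℝ) + 1) ^ sigma := by
  by_cases hk : Hseq ft lam v kappa α h X mu (k + 1) - Hseq ft lam v kappa α h X mu k
      ≤ -a * mu k ^ 2
  · exact Or.inl (hrun.keep k hk)
  · exact Or.inr (hrun.shrink k hk)

lemma IsRun.mu_pos (hrun : IsRun ft lam v mubar kappa sigma a α β h X mu) (k : ℕ) : 0 < mu k := by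
  have h0 := hrun.mu_zero.1
  induction k with
  | zero => exact h0
  | succ k ih => rcases hrun.mu_succ_eq k with h | h <;> rw [h] <;> positivity

/-- A kept parameter stays above the decreasing target sequence. Consequently a reset never
increases the parameter. -/
lemma IsRun.div_rpow_le_mu_succ (hrun : IsRun ft lam v mubar kappa sigma a α β h X mu)
    (hsigma : 0 < sigma) (k : ℕ) : mu 0 / ((k : ℝ) + 1) ^ sigma ≤ mu (k + 1) := by
  have h0 := hrun.mu_zero.1
  induction k with
  | zero => rcases hrun.mu_succ_eq 0 with h | h <;> simp [h]
  | succ k ih =>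
    rcases hrun.mu_succ_eq (k + 1) with h | h
    · rw [h]
      refine le_trans ?_ ih
      gcongr
      simp
    · exact h.ge

lemma IsRun.mu_antitone (hrun : IsRun ft lam v mubar kappa sigma a α β h X mu)
    (hsigma : 0 < sigma) : Antitone mu := by
  have h0 := hrun.mu_zero.1
  refine antitone_nat_of_succ_le fun k => ?_
  rcases hrun.mu_succ_eq k with h | h
  · exact h.le
  · rw [h]
    cases k with
    | zero => simp
    | succ k =>
      refine le_trans ?_ (hrun.div_rpow_le_mu_succ hsigma k)
      gcongr
      simp

lemma IsRun.mu_mem (hrun : IsRun ft lam v mubar kappa sigma a α β h X mu)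
    (hsigma : 0 < sigma) (k : ℕ) : mu k ∈ Set.Ioc 0 mubar :=
  ⟨hrun.mu_pos k, (hrun.mu_antitone hsigma k.zero_le).trans hrun.mu_zero.2⟩

/-- Nontriviality of the filter says that 𝒩ˢ is unbounded. At its indices the parameter is reset to
a value tending to zero, and monotonicity does the rest. -/
lemma IsRun.tendsto_mu (hrun : IsRun ft lam v mubar kappa sigma a α β h X mu)
    (hsigma : 0 < sigma) [hNs : NeBot (atTop ⊓ 𝓟 (Ns mu))] : Tendsto mu atTop (𝓝 0) := by
  have hlim : Tendsto (fun k : ℕ => mu 0 / ((k : ℝ) + 1) ^ sigma) atTop (𝓝 0) :=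
    tendsto_const_nhds.div_atTop ((tendsto_rpow_atTop hsigma).comp
      (tendsto_atTop_add_const_right _ _ tendsto_natCast_atTop_atTop))
  rw [Metric.tendsto_atTop]
  intro δ hδ
  have hev : ∀ᶠ k : ℕ in atTop ⊓ 𝓟 (Ns mu), mu 0 / ((k : ℝ) + 1) ^ sigma < δ ∧ k ∈ Ns mu :=
    ((hlim.eventually_lt_const hδ).filter_mono inf_le_left).and
      (mem_inf_of_right (mem_principal_self _))
  obtain ⟨k, hk, hkN⟩ := hev.exists
  refine ⟨k + 1, fun j hj => ?_⟩
  rw [Real.dist_eq, sub_zero, abs_of_pos (hrun.mu_pos j)]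
  refine (hrun.mu_antitone hsigma hj).trans_lt ?_
  rcases hrun.mu_succ_eq k with h | h
  · exact absurd h hkN
  · rwa [h]

lemma prev_mu_mem (hrun : IsRun ft lam v mubar kappa sigma a α β h X mu)
    (hsigma : 0 < sigma) (k : ℕ) : prev mu k ∈ Set.Ioc 0 mubar := by
  cases k with
  | zero => exact hrun.mu_mem hsigma 0
  | succ k => exact hrun.mu_mem hsigma k

lemma mu_le_prev (hrun : IsRun ft lam v mubar kappa sigma a α β h X mu)
    (hsigma : 0 < sigma) (k : ℕ) : mu k ≤ prev mu k := by
  cases k with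
  | zero => exact le_rfl
  | succ k => exact hrun.mu_antitone hsigma k.le_succ

end Smoothing

/-! ### Decrease of the potential and its consequences on 𝒩ˢ -/

section Decrease

variable {m n : ℕ} {f : Mat m n → ℝ} {ft : Mat m n → ℝ → ℝ}
  {lam v mubar kappa Lt sigma a ε : ℝ} {α β h : ℕ → ℝ} {X : ℕ → Mat m n} {mu : ℕ → ℝ}

/-- Adding the two bounds cancels `β k` and the isolated `α k`. -/
lemma ParameterConstraints.Lt_le (hpar : ParameterConstraints sigma Lt ε α β h mu)
    (hmu : ∀ k, 0 < mu k) (k : ℕ) : Lt ≤ h k := by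
  have h1 := hpar.h_bound₁ k
  have h2 := hpar.h_bound₂ k
  have h3 : 0 ≤ (α k + ε) * (mu k / mu (k + 1)) :=
    mul_nonneg (add_nonneg (hpar.alpha_nonneg k) hpar.eps_pos.le)
      (div_pos (hmu k) (hmu (k + 1))).le
  have h4 := mul_nonneg (hpar.h_pos k).le h3
  linarith

/-- The value of `f̃ + λΦ + κμ` at the new iterate and the old smoothing parameter, plus
the inertial term, bounds the potential from below. -/
lemma le_Hseq (hft : IsSmoothing f ft mubar kappa Lt)
    (hrun : IsRun ft lam v mubar kappa sigma a α β h X mu) (hsigma : 0 < sigma) (k : ℕ) :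
    ft (X k) (mu k) + lam * Phi v (X k) + kappa * mu k
      + h k * α k / 2 * (mu k)⁻¹ * ‖X k - prev X k‖ ^ 2 ≤ Hseq ft lam v kappa α h X mu k := by
  have h1 := hrun.mu_mem hsigma k
  have h2 := prev_mu_mem hrun hsigma k
  have h3 := (abs_le.1 (hft.lipschitz_mu (X k) (prev mu k) ⟨h2.1.le, h2.2⟩ (mu k)
    ⟨h1.1.le, h1.2⟩)).2
  rw [abs_of_nonneg (sub_nonneg.2 (mu_le_prev hrun hsigma k))] at h3
  unfold Hseq
  linarith

/-- One step of the algorithm decreases the potential sufficiently. -/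
lemma Hseq_succ_add_le (hft : IsSmoothing f ft mubar kappa Lt) (hlam : 0 < lam) (hv : 0 < v)
    (hrun : IsRun ft lam v mubar kappa sigma a α β h X mu) (hsigma : 0 < sigma)
    (hpar : ParameterConstraints sigma Lt ε α β h mu) (k : ℕ) :
    Hseq ft lam v kappa α h X mu (k + 1) + h k * ε / 2 * (mu (k + 1))⁻¹ * ‖X (k + 1) - X k‖ ^ 2
      ≤ Hseq ft lam v kappa α h X mu k := by
  refine le_trans ?_ (le_Hseq hft hrun hsigma k)
  have hmu := hrun.mu_mem hsigma k
  have hmu0 := hmu.1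
  have hmu1 := hrun.mu_pos (k + 1)
  have hg := (hft.contDiff _ hmu).differentiable one_ne_zero
  set D := X k - prev X k with hD
  set D' := X (k + 1) - X k with hD'
  set Z := extrapolate X (β k) k with hZ
  set Y := extrapolate X (α k) k with hY
  set g := grad (fun W => ft W (mu k)) Z with hgdef
  have hstep := hrun.step k (X k)
  unfold Q at hstep
  rw [PhiD_dOf hv, ← hZ, ← hY, ← hgdef] at hstep
  have hPhi := mul_le_mul_of_nonneg_left (Phi_le_PhiD v (dOf v (X k)) (X (k + 1))) hlam.le
  have e1 : X (k + 1) - Y = D' - α k • D := by rw [hY, extrapolate, ← hD, hD']; abel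
  have e2 : X k - Y = -(α k • D) := by rw [hY, extrapolate, ← hD]; abel
  have e3 : X (k + 1) = Z + (D' - β k • D) := by rw [hZ, extrapolate, ← hD, hD']; abel
  have e4 : X k = Z + -(β k • D) := by rw [hZ, extrapolate, ← hD]; abel
  -- Descent lemma from `Z` to the new iterate, convexity from `Z` to the old one: in the difference
  -- the linear terms combine to `⟨g, D'⟩`, which `hstep` cancels.
  have hdesc := le_add_frobInner_grad_add hg (hft.lipschitz_grad _ hmu) Z (D' - β k • D)
  have hconv := add_frobInner_grad_le hg (hft.convex _ hmu) Z (-(β k • D))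
  rw [← e3] at hdesc
  rw [← e4] at hconv
  rw [e1, e2, norm_neg] at hstep
  have hneg : frobInner (-(α k • D)) g = - (α k * frobInner D g) := by
    rw [← frobInner_smul_left]; simp [frobInner]
  have hneg2 : frobInner g (-(β k • D)) = - (β k * frobInner D g) := by
    rw [frobInner_comm D g, ← frobInner_smul_right]; simp [frobInner]
  rw [hneg2] at hconv
  rw [hneg, frobInner_sub_left, frobInner_smul_left, norm_sub_sq_frob, frobInner_smul_right,
    norm_smul, mul_pow, Real.norm_eq_abs, sq_abs] at hstep
  rw [frobInner_sub_right, frobInner_smul_right, frobInner_comm _ D, frobInner_comm _ D',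
    norm_sub_sq_frob, frobInner_smul_right, norm_smul, mul_pow, Real.norm_eq_abs, sq_abs] at hdesc
  have hcs : 2 * frobInner D' D ≤ ‖D'‖ ^ 2 + ‖D‖ ^ 2 := by
    have := sq_nonneg ‖D' - D‖
    rw [norm_sub_sq_frob] at this
    linarith
  have hb1 := hpar.h_bound₁ k
  have hb2 := hpar.h_bound₂ k
  have hβ := hpar.beta_mem k
  have hLt := hft.Lt_pos
  -- The cross term has coefficient `2 * (h k * α k - β k * Lt)`, nonnegative by `h_bound₂`, so
  -- `hcs` applies. Then `h_bound₁` bounds the coefficient of `‖D'‖ ^ 2`, and `β k ≤ 1` that of `‖D‖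
  -- ^ 2`.
  have hquad : Lt * (‖D'‖ ^ 2 - 2 * (β k * frobInner D' D) + β k ^ 2 * ‖D‖ ^ 2)
      - h k * (‖D'‖ ^ 2 - 2 * (α k * frobInner D' D) + α k ^ 2 * ‖D‖ ^ 2)
      + h k * (α k ^ 2 * ‖D‖ ^ 2) ≤ h k * α k * ‖D‖ ^ 2
        - h k * (α k + ε) * (mu k / mu (k + 1)) * ‖D'‖ ^ 2 := by
    have q1 := mul_le_mul_of_nonneg_left hcs (sub_nonneg.2 hb2)
    have q2 := mul_le_mul_of_nonneg_right hb1 (sq_nonneg ‖D'‖)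
    have q3 : 0 ≤ Lt * β k * (1 - β k) * ‖D‖ ^ 2 :=
      mul_nonneg (mul_nonneg (mul_nonneg hLt.le hβ.1) (sub_nonneg.2 hβ.2)) (sq_nonneg _)
    linarith
  have hquad2 := mul_le_mul_of_nonneg_left hquad (inv_pos.2 hmu0).le
  -- The ratio in `h_bound₁` turns the weight `(mu k)⁻¹` into the weight `(mu (k + 1))⁻¹` of the
  -- next potential.
  have hdiv : (mu k)⁻¹ * (h k * (α k + ε) * (mu k / mu (k + 1)) * ‖D'‖ ^ 2)
      = h k * (α k + ε) * (mu (k + 1))⁻¹ * ‖D'‖ ^ 2 := by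
    field_simp
  rw [mul_sub, hdiv] at hquad2
  have hpar2 : h (k + 1) * α (k + 1) / 2 * (mu (k + 1))⁻¹ * ‖D'‖ ^ 2
      ≤ h k * α k / 2 * (mu (k + 1))⁻¹ * ‖D'‖ ^ 2 := by
    have := mul_le_mul (hpar.h_antitone k.le_succ) (hpar.alpha_antitone k.le_succ)
      (hpar.alpha_nonneg _) (hpar.h_pos k).le
    gcongr
  have hH : Hseq ft lam v kappa α h X mu (k + 1) = ft (X (k + 1)) (mu k) + lam * Phi v (X (k + 1))
      + kappa * mu k + h (k + 1) * α (k + 1) / 2 * (mu (k + 1))⁻¹ * ‖D'‖ ^ 2 := rfl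
  rw [hH]
  linarith

lemma norm_sub_sq_le_of_mem_Ns (hft : IsSmoothing f ft mubar kappa Lt) (hlam : 0 < lam)
    (hv : 0 < v) (hrun : IsRun ft lam v mubar kappa sigma a α β h X mu) (hsigma : 0 < sigma)
    (hpar : ParameterConstraints sigma Lt ε α β h mu) {k : ℕ} (hk : k ∈ Ns mu) :
    ‖X (k + 1) - X k‖ ^ 2 ≤ 2 * a / (Lt * ε) * mu (k + 1) * mu k ^ 2 := by
  have h1 := Hseq_succ_add_le hft hlam hv hrun hsigma hpar k
  have h2 := not_le.1 fun hle => hk (hrun.keep k hle)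
  have hmu1 := hrun.mu_pos (k + 1)
  have hLt := hft.Lt_pos
  have hε := hpar.eps_pos
  have h3 : Lt * ε / 2 * (mu (k + 1))⁻¹ * ‖X (k + 1) - X k‖ ^ 2 ≤ a * mu k ^ 2 := by
    have : Lt * ε / 2 * (mu (k + 1))⁻¹ * ‖X (k + 1) - X k‖ ^ 2
        ≤ h k * ε / 2 * (mu (k + 1))⁻¹ * ‖X (k + 1) - X k‖ ^ 2 := by
      have := hpar.Lt_le hrun.mu_pos k
      gcongr
    linarith
  have h4 := mul_le_mul_of_nonneg_left h3 (show 0 ≤ 2 / (Lt * ε) * mu (k + 1) by positivity)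
  calc _ = 2 / (Lt * ε) * mu (k + 1)
        * (Lt * ε / 2 * (mu (k + 1))⁻¹ * ‖X (k + 1) - X k‖ ^ 2) := by field_simp
    _ ≤ _ := h4
    _ = _ := by ring

/-- The inertial term is read off from the potential at `k`, which the failed test bounds by the
potential at `k + 1`; no information on step `k - 1` is used. -/
lemma inertial_le_of_mem_Ns (hmn : n ≤ m) {Lf : NNReal} (hf : LipschitzWith Lf f)
    (hft : IsSmoothing f ft mubar kappa Lt) (hlam : 0 < lam)
    (hv : 0 < v) (hrun : IsRun ft lam v mubar kappa sigma a α β h X mu) (hsigma : 0 < sigma)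
    (hpar : ParameterConstraints sigma Lt ε α β h mu) {k : ℕ} (hk : k ∈ Ns mu) :
    h k * α k * (‖X k - prev X k‖ / mu k) ^ 2 ≤ 2 * ((a + h 0 * α 0 * (a / (Lt * ε))) * mu k
      + (Lf + lam * (n / v)) * (‖X (k + 1) - X k‖ / mu k)) := by
  have h1 := le_Hseq hft hrun hsigma k
  have h2 := not_le.1 fun hle => hk (hrun.keep k hle)
  have h3 := norm_sub_sq_le_of_mem_Ns hft hlam hv hrun hsigma hpar hk
  have hmu := hrun.mu_pos k
  have hmu1 := hrun.mu_pos (k + 1)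
  have hH : Hseq ft lam v kappa α h X mu (k + 1) = ft (X (k + 1)) (mu k) + lam * Phi v (X (k + 1))
      + kappa * mu k
      + h (k + 1) * α (k + 1) / 2 * (mu (k + 1))⁻¹ * ‖X (k + 1) - X k‖ ^ 2 := rfl
  -- The factor `mu (k + 1)` in `norm_sub_sq_le_of_mem_Ns` cancels the inverse weight.
  have h4 : h (k + 1) * α (k + 1) / 2 * (mu (k + 1))⁻¹ * ‖X (k + 1) - X k‖ ^ 2
      ≤ h 0 * α 0 * (a / (Lt * ε)) * mu k ^ 2 := by
    have := mul_le_mul (hpar.h_antitone (k + 1).zero_le) (hpar.alpha_antitone (k + 1).zero_le)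
      (hpar.alpha_nonneg _) (hpar.h_pos 0).le
    have h0 := mul_nonneg (hpar.h_pos 0).le (hpar.alpha_nonneg 0)
    calc _ ≤ h 0 * α 0 / 2 * (mu (k + 1))⁻¹ * (2 * a / (Lt * ε) * mu (k + 1) * mu k ^ 2) := by
          gcongr
      _ = _ := by field_simp
  have h5 := hft.ft_sub_le hf (hrun.mu_mem hsigma k) (X (k + 1)) (X k)
  have h6 := mul_le_mul_of_nonneg_left (Phi_sub_le hmn hv (X (k + 1)) (X k)) hlam.le
  have h7 : h k * α k / 2 * (mu k)⁻¹ * ‖X k - prev X k‖ ^ 2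
      ≤ (a + h 0 * α 0 * (a / (Lt * ε))) * mu k ^ 2
        + (Lf + lam * (n / v)) * ‖X (k + 1) - X k‖ := by
    rw [hH] at h2
    linarith
  have h8 := mul_le_mul_of_nonneg_left h7 (show 0 ≤ 2 * (mu k)⁻¹ by positivity)
  calc _ = 2 * (mu k)⁻¹ * (h k * α k / 2 * (mu k)⁻¹ * ‖X k - prev X k‖ ^ 2) := by field_simp
    _ ≤ _ := h8
    _ = _ := by field_simp

lemma tendsto_norm_sub_div (hft : IsSmoothing f ft mubar kappa Lt) (hlam : 0 < lam)
    (hv : 0 < v) (hrun : IsRun ft lam v mubar kappa sigma a α β h X mu) (hsigma : 0 < sigma)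
    (hpar : ParameterConstraints sigma Lt ε α β h mu) (hNs : NeBot (atTop ⊓ 𝓟 (Ns mu))) :
    Tendsto (fun k => ‖X (k + 1) - X k‖ / mu k) (atTop ⊓ 𝓟 (Ns mu)) (𝓝 0) := by
  have hmu := (hrun.tendsto_mu hsigma).comp (tendsto_add_atTop_nat 1)
  have hlim : Tendsto (fun k => √(2 * a / (Lt * ε) * mu (k + 1))) (atTop ⊓ 𝓟 (Ns mu)) (𝓝 0) := by
    have := (Real.continuous_sqrt.tendsto _).comp (hmu.const_mul (2 * a / (Lt * ε)))
    simp only [mul_zero, Real.sqrt_zero] at this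
    exact this.mono_left inf_le_left
  refine tendsto_of_tendsto_of_tendsto_of_le_of_le' tendsto_const_nhds hlim
    (Eventually.of_forall fun k => div_nonneg (norm_nonneg _) (hrun.mu_pos k).le) ?_
  filter_upwards [mem_inf_of_right (mem_principal_self (Ns mu))] with k hk
  have hpos := hrun.mu_pos k
  refine Real.le_sqrt_of_sq_le ?_
  rw [div_pow, div_le_iff₀ (by positivity)]
  exact norm_sub_sq_le_of_mem_Ns hft hlam hv hrun hsigma hpar hk

lemma tendsto_inertial_div (hmn : n ≤ m) {Lf : NNReal} (hf : LipschitzWith Lf f)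
    (hft : IsSmoothing f ft mubar kappa Lt) (hlam : 0 < lam)
    (hv : 0 < v) (hrun : IsRun ft lam v mubar kappa sigma a α β h X mu) (hsigma : 0 < sigma)
    (hpar : ParameterConstraints sigma Lt ε α β h mu) (hNs : NeBot (atTop ⊓ 𝓟 (Ns mu))) :
    Tendsto (fun k => h k * α k * (‖X k - prev X k‖ / mu k)) (atTop ⊓ 𝓟 (Ns mu)) (𝓝 0) := by
  have hmu := (hrun.tendsto_mu hsigma).mono_left (inf_le_left (b := 𝓟 (Ns mu)))
  have hD := tendsto_norm_sub_div hft hlam hv hrun hsigma hpar hNs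
  have hlim : Tendsto (fun k => √(h 0 * α 0 * (2 * ((a + h 0 * α 0 * (a / (Lt * ε))) * mu k
      + (Lf + lam * (n / v)) * (‖X (k + 1) - X k‖ / mu k))))) (atTop ⊓ 𝓟 (Ns mu)) (𝓝 0) := by
    have h1 := ((hmu.const_mul (a + h 0 * α 0 * (a / (Lt * ε)))).add
      (hD.const_mul (Lf + lam * (n / v)))).const_mul 2 |>.const_mul (h 0 * α 0)
    have := (Real.continuous_sqrt.tendsto _).comp h1
    simp only [mul_zero, add_zero, Real.sqrt_zero] at this
    exact this
  have h0 : ∀ k, 0 ≤ h k * α k := fun k => mul_nonneg (hpar.h_pos k).le (hpar.alpha_nonneg k)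
  refine tendsto_of_tendsto_of_tendsto_of_le_of_le' tendsto_const_nhds hlim
    (Eventually.of_forall fun k => mul_nonneg (h0 k)
      (div_nonneg (norm_nonneg _) (hrun.mu_pos k).le)) ?_
  filter_upwards [mem_inf_of_right (mem_principal_self (Ns mu))] with k hk
  refine Real.le_sqrt_of_sq_le ?_
  -- One factor `h k * α k` is bounded by its value at `0`, the other stays with the square. The
  -- weight is kept because `α k` may vanish.
  rw [mul_pow, pow_two (h k * α k), mul_assoc]
  have h1 := inertial_le_of_mem_Ns hmn hf hft hlam hv hrun hsigma hpar hk
  have h2 := mul_le_mul (hpar.h_antitone k.zero_le) (hpar.alpha_antitone k.zero_le)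
    (hpar.alpha_nonneg _) (hpar.h_pos 0).le
  exact mul_le_mul h2 h1 (mul_nonneg (h0 k) (sq_nonneg _)) (h0 0)

end Decrease

/-! ### Passage to the limit along an ultrafilter -/

section Limits

variable {m n : ℕ}

lemma exists_tendsto_of_norm_le {ι : Type*} (F : Ultrafilter ι) {u : ι → Mat m n} {C : ℝ}
    (hu : ∀ k, ‖u k‖ ≤ C) : ∃ A, Tendsto u F (𝓝 A) := by
  have : ProperSpace (Mat m n) := FiniteDimensional.proper ℝ _
  have hmem : Metric.closedBall (0 : Mat m n) C ∈ F.map u :=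
    Ultrafilter.mem_map.2 (univ_mem' fun k => by simpa using hu k)
  obtain ⟨A, -, hA⟩ := (isCompact_closedBall (0 : Mat m n) C).ultrafilter_le_nhds' _ hmem
  exact ⟨A, hA⟩

lemma exists_tendsto_of_orthogonal {ι : Type*} {k : ℕ} (F : Ultrafilter ι) {U : ι → Mat k k}
    (hU : ∀ i, U i ∈ Matrix.orthogonalGroup (Fin k) ℝ) :
    ∃ A ∈ Matrix.orthogonalGroup (Fin k) ℝ, Tendsto U F (𝓝 A) := by
  obtain ⟨A, hA⟩ := exists_tendsto_of_norm_le F (u := U) (C := √k) fun i => by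
    refine Real.le_sqrt_of_sq_le ?_
    rw [norm_sq_eq_frobInner, frobInner, transpose_mul_self_of_orthogonal (hU i)]
    simp
  refine ⟨A, ?_, hA⟩
  have hcont : Continuous fun W : Mat k k => W.transpose * W := by fun_prop
  have h1 := (hcont.tendsto A).comp hA
  have h2 : Tendsto (fun i => (U i).transpose * U i) F (𝓝 1) :=
    tendsto_const_nhds.congr fun i => (transpose_mul_self_of_orthogonal (hU i)).symm
  exact (Matrix.mem_orthogonalGroup_iff' (Fin k) ℝ).2 (tendsto_nhds_unique h1 h2)

lemma exists_eventually_eq_of_finite {ι β : Type*} [Finite β] (F : Ultrafilter ι) (d : ι → β) :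
    ∃ b, ∀ᶠ k in F, d k = b := by
  obtain ⟨b, hb⟩ := (F.map d).eq_pure_of_finite
  refine ⟨b, ?_⟩
  have : {b} ∈ F.map d := by rw [hb]; exact Ultrafilter.mem_pure.2 rfl
  exact Ultrafilter.mem_map.1 this

/-- Gradient consistency is assumed for sequences only. The limit triple lies in the closure of the
triples attained, and first countability supplies a sequence of them, in whatever order of indices.
-/
lemma IsSmoothing.grad_limit_mem {f : Mat m n → ℝ} {ft : Mat m n → ℝ → ℝ} {mubar kappa Lt : ℝ}
    (hft : IsSmoothing f ft mubar kappa Lt) {ι : Type*} {F : Filter ι} [NeBot F]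
    {Z : ι → Mat m n} {mu : ι → ℝ} {A G : Mat m n} (hZ : Tendsto Z F (𝓝 A))
    (hmu : ∀ k, mu k ∈ Set.Ioc 0 mubar) (hmu0 : Tendsto mu F (𝓝 0))
    (hG : Tendsto (fun k => grad (fun W => ft W (mu k)) (Z k)) F (𝓝 G)) :
    G ∈ clarkeSubdiff f A := by
  set φ : ι → Mat m n × ℝ × Mat m n :=
    fun k => (Z k, mu k, grad (fun W => ft W (mu k)) (Z k)) with hφ
  have hlim : Tendsto φ F (𝓝 (A, 0, G)) := hZ.prodMk_nhds (hmu0.prodMk_nhds hG)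
  have hcl : (A, (0 : ℝ), G) ∈ closure (Set.range φ) :=
    mem_closure_of_tendsto hlim (Eventually.of_forall fun k => Set.mem_range_self k)
  have : FirstCountableTopology (Mat m n) :=
    inferInstanceAs (FirstCountableTopology (Fin m → Fin n → ℝ))
  obtain ⟨x, hx, hxlim⟩ := mem_closure_iff_seq_limit.1 hcl
  choose k hk using hx
  obtain rfl : (fun j => φ (k j)) = x := funext hk
  exact hft.grad_consistent A G (fun j => Z (k j)) (fun j => mu (k j))
    ((continuous_fst.tendsto _).comp hxlim) (fun j => hmu _)
    (((continuous_fst.comp continuous_snd).tendsto _).comp hxlim)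
    (((continuous_snd.comp continuous_snd).tendsto _).comp hxlim)

lemma deriv_theta {v : ℝ} (d : Fin n → Fin 2) (i : Fin n) (t : ℝ) :
    deriv (theta v (d i)) t = pieceInd d i / v := by
  have : theta v (d i) = fun t => pieceInd d i * (t / v - 1) := funext fun t => theta_eq v d i t
  rw [this]
  simp [div_eq_mul_inv]

/-- The optimality system with diagonal `ρ` gives lifted stationarity. -/
lemma isLiftedStationary_of_diag {f : Mat m n → ℝ} {lam v : ℝ} (hlam : 0 < lam) (hv : 0 < v)
    {X : Mat m n} {d : Fin n → Fin 2} (hd : ∀ i, d i ∈ activePieces v (sv X i))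
    {U : Mat m m} {V : Mat n n} (hsvd : IsSVD X U V) {G : Mat m n} (hG : G ∈ clarkeSubdiff f X)
    {ρ : Fin n → ℝ} (hρ : U.transpose * G * V = rectDiag m ρ)
    (hopt : ∀ i η, 0 ≤ ρ i * η + lam / v * (1 - pieceInd d i) * (|sv X i + η| - sv X i)) :
    IsLiftedStationary f lam v X := by
  have hlv : 0 < lam / v := by positivity
  -- The stationarity equation forces this `s`. It is a subgradient since `hopt` bounds `s i * η` by
  -- the convex combination, with weight `pieceInd d i`, of `η` and `|sv X i + η| - sv X i`, and the
  -- former is at most the latter.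
  refine ⟨d, hd, U, V, hsvd, G, hG, pieceInd d - (lam / v)⁻¹ • ρ, ?_, ?_⟩
  · refine mem_clarkeSubdiffVec_l1 fun i η => ?_
    rw [abs_sv]
    have key : ∀ η, pieceInd d i * η - (lam / v)⁻¹ * (ρ i * η)
        ≤ pieceInd d i * η + (1 - pieceInd d i) * (|sv X i + η| - sv X i) := by
      intro η
      have h1 := mul_le_mul_of_nonneg_left (hopt i η) (inv_pos.2 hlv).le
      rw [mul_zero, mul_add, mul_assoc, inv_mul_cancel_left₀ hlv.ne'] at h1
      linarith
    have h2 : pieceInd d i * η ≤ pieceInd d i * (|sv X i + η| - sv X i) :=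
      mul_le_mul_of_nonneg_left (by linarith [le_abs_self (sv X i + η)]) (pieceInd_nonneg d i)
    simp only [Pi.sub_apply, Pi.smul_apply, smul_eq_mul]
    have := key η
    linarith
  · rw [rectDiag_sum_single, hρ, ← rectDiag_smul, ← rectDiag_smul, ← rectDiag_add]
    congr 1
    ext i
    simp only [Pi.smul_apply, Pi.add_apply, Pi.sub_apply, smul_eq_mul, deriv_theta]
    field_simp
    ring

/-- A strict inequality `sv < v` may become an equality in the limit; at `v` both pieces are active,
so the frozen choice `d` remains admissible even where it differs from that of the limit point. -/
lemma mem_activePieces_of_limit {ι : Type*} {F : Filter ι} [NeBot F] (hmn : n ≤ m) {v : ℝ}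
    (hv : 0 < v) {X : ι → Mat m n} {A : Mat m n} (hX : Tendsto X F (𝓝 A)) {d : Fin n → Fin 2}
    (hd : ∀ᶠ k in F, dOf v (X k) = d) (i : Fin n) : d i ∈ activePieces v (sv A i) := by
  have hlim : Tendsto (fun k => sv (X k) i) F (𝓝 (sv A i)) :=
    ((continuous_sv hmn i).tendsto A).comp hX
  by_cases hdi : d i = 0
  · have hle : sv A i ≤ v := le_of_tendsto hlim <| hd.mono fun k hk => by
      by_contra hlt
      have := congrFun hk i
      rw [hdi, dOf, if_neg fun h => hlt h.le] at this
      exact one_ne_zero this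
    have := (div_le_one hv).2 hle
    simp [activePieces, theta, hdi, this]
  · have hle : v ≤ sv A i := ge_of_tendsto hlim <| hd.mono fun k hk => by
      by_contra hlt
      have := congrFun hk i
      rw [dOf, if_pos (not_le.1 hlt)] at this
      exact hdi this.symm
    have := (one_le_div hv).2 hle
    simp [activePieces, theta, hdi, this]

end Limits

end GIMSPG

/-! ### Proof of the theorem -/

open GIMSPG

theorem mainTheorem2 {m n : ℕ} (hmn : n ≤ m)
    -- the relaxed problem `min f + lam * Φ` and the standing assumptions on it
    (f : GIMSPG.Mat m n → ℝ) (lam v : ℝ) (Lf : NNReal)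
    (hf_nonneg : ∀ X, 0 ≤ f X) (hf_convex : ConvexOn ℝ Set.univ f)
    (hf_lip : LipschitzWith Lf f) (hlam : 0 < lam) (hv : 0 < v) (hvL : v * Lf < lam)
    (hlevel : ∀ c : ℝ, Bornology.IsBounded {X | f X + lam * GIMSPG.Phi v X ≤ c})
    -- the smoothing function
    (ft : GIMSPG.Mat m n → ℝ → ℝ) (mubar kappa Lt : ℝ)
    (hft : GIMSPG.IsSmoothing f ft mubar kappa Lt)
    -- the algorithm and its parameters
    (sigma a ε : ℝ) (hsigma : sigma ∈ Set.Ioo (0 : ℝ) 1) (ha : 0 < a)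
    (α β h : ℕ → ℝ) (X : ℕ → GIMSPG.Mat m n) (mu : ℕ → ℝ)
    (hrun : GIMSPG.IsRun ft lam v mubar kappa sigma a α β h X mu)
    (hpar : GIMSPG.ParameterConstraints sigma Lt ε α β h mu)
    -- an accumulation point of `{X^k : k ∈ 𝒩ˢ}`
    (Xbar : GIMSPG.Mat m n)
    (hacc : MapClusterPt Xbar (atTop ⊓ 𝓟 (GIMSPG.Ns mu)) X) :
    GIMSPG.IsLiftedStationary f lam v Xbar := by
  -- Along an ultrafilter all bounded quantities converge at once, without successive subsequences.
  obtain ⟨F, hF, hX⟩ := mapClusterPt_iff_ultrafilter.1 hacc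
  have hNs : NeBot (atTop ⊓ 𝓟 (Ns mu)) := neBot_of_le hF
  have hmu : Tendsto mu F (𝓝 0) :=
    (hrun.tendsto_mu hsigma.1).mono_left (hF.trans inf_le_left)
  have hD' := (tendsto_norm_sub_div hft hlam hv hrun hsigma.1 hpar hNs).mono_left hF
  have hD := (tendsto_inertial_div hmn hf_lip hft hlam hv hrun hsigma.1 hpar hNs).mono_left hF
  have hsvd : ∀ k, ∃ U V, IsSVD (X (k + 1)) U V ∧ ∃ ρ : Fin n → ℝ,
      U.transpose * (grad (fun W => ft W (mu k)) (extrapolate X (β k) k)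
        + (h k * (mu k)⁻¹) • (X (k + 1) - extrapolate X (α k) k)) * V = rectDiag m ρ ∧
      ∀ i η, 0 ≤ ρ i * η + lam / v * (1 - pieceInd (dOf v (X k)) i)
        * (|sv (X (k + 1)) i + η| - sv (X (k + 1)) i) := fun k =>
    exists_svd_of_isMin hmn hlam hv (pieceInd_dOf_antitone v (X k)) (hrun.step k)
  choose U V hUV ρ hρ hopt using hsvd
  obtain ⟨Ubar, hUbar, hU⟩ := exists_tendsto_of_orthogonal F fun k => (hUV k).1
  obtain ⟨Vbar, hVbar, hV⟩ := exists_tendsto_of_orthogonal F fun k => (hUV k).2.1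
  obtain ⟨G, hG⟩ := exists_tendsto_of_norm_le F
    fun k => hft.norm_grad_le hf_lip (hrun.mu_mem hsigma.1 k) (extrapolate X (β k) k)
  obtain ⟨d, hd⟩ := exists_eventually_eq_of_finite F fun k => dOf v (X k)
  have hdiff : Tendsto (fun k => X (k + 1) - X k) F (𝓝 0) := by
    have := hmu.mul hD'
    rw [mul_zero] at this
    exact squeeze_zero_norm (fun k => (mul_div_cancel₀ _ (hrun.mu_pos k).ne').ge) this
  have hX1 : Tendsto (fun k => X (k + 1)) F (𝓝 Xbar) := by
    have := hdiff.add hX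
    rw [zero_add] at this
    exact this.congr fun k => sub_add_cancel _ _
  have hZ : Tendsto (fun k => extrapolate X (β k) k) F (𝓝 Xbar) := by
    -- The bound `β k * Lt ≤ h k * α k` reduces this to the weighted inertial limit.
    have h1 : Tendsto (fun k => β k • (X k - prev X k)) F (𝓝 0) := by
      have h2 := (hmu.mul hD).const_mul Lt⁻¹
      rw [mul_zero, mul_zero] at h2
      refine squeeze_zero_norm (fun k => ?_) h2
      have hmupos := hrun.mu_pos k
      have hLt := hft.Lt_pos
      rw [norm_smul, Real.norm_of_nonneg (hpar.beta_mem k).1]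
      calc β k * ‖X k - prev X k‖ = Lt⁻¹ * (β k * Lt * ‖X k - prev X k‖) := by field_simp
        _ ≤ Lt⁻¹ * (h k * α k * ‖X k - prev X k‖) := by
          have := hpar.h_bound₂ k
          gcongr
        _ = _ := by field_simp
    have := hX.add h1
    rwa [add_zero] at this
  have hR : Tendsto (fun k => (h k * (mu k)⁻¹) • (X (k + 1) - extrapolate X (α k) k)) F
      (𝓝 0) := by
    have h2 := (hD'.const_mul (h 0)).add hD
    rw [mul_zero, add_zero] at h2
    refine squeeze_zero_norm (fun k => ?_) h2
    have hmupos := hrun.mu_pos k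
    have hk := hpar.h_pos k
    have h3 : X (k + 1) - extrapolate X (α k) k
        = (X (k + 1) - X k) - α k • (X k - prev X k) := by
      rw [extrapolate]; abel
    rw [h3, norm_smul, Real.norm_of_nonneg (by positivity)]
    have h4 := norm_sub_le (X (k + 1) - X k) (α k • (X k - prev X k))
    rw [norm_smul, Real.norm_of_nonneg (hpar.alpha_nonneg k)] at h4
    calc _ ≤ h k * (mu k)⁻¹ * (‖X (k + 1) - X k‖ + α k * ‖X k - prev X k‖) := by gcongr
      _ = h k * (‖X (k + 1) - X k‖ / mu k) + h k * α k * (‖X k - prev X k‖ / mu k) := by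
        field_simp
      _ ≤ _ := by
        have := hpar.h_antitone k.zero_le
        gcongr
  have hsv : ∀ i, Tendsto (fun k => sv (X (k + 1)) i) F (𝓝 (sv Xbar i)) := fun i =>
    ((continuous_sv hmn i).tendsto Xbar).comp hX1
  have hconj : Continuous fun p : Mat m m × Mat m n × Mat n n =>
      p.1.transpose * p.2.1 * p.2.2 := by fun_prop
  have hconj' : Continuous fun p : Mat m m × Mat m n × Mat n n =>
      p.1 * p.2.1 * p.2.2.transpose := by fun_prop
  have hXbar : IsSVD Xbar Ubar Vbar := by
    refine ⟨hUbar, hVbar, tendsto_nhds_unique hX1 ?_⟩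
    have h1 : Tendsto (fun k => rectDiag m (sv (X (k + 1)))) F (𝓝 (rectDiag m (sv Xbar))) :=
      (continuous_rectDiag.tendsto _).comp (tendsto_pi_nhds.2 hsv)
    have h2 := (hconj'.tendsto _).comp (hU.prodMk_nhds (h1.prodMk_nhds hV))
    exact h2.congr fun k => (hUV k).2.2.symm
  have hlim : Tendsto (fun k => rectDiag m (ρ k)) F (𝓝 (Ubar.transpose * G * Vbar)) := by
    have h1 := hG.add hR
    rw [add_zero] at h1
    have h2 := (hconj.tendsto _).comp (hU.prodMk_nhds (h1.prodMk_nhds hV))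
    exact h2.congr hρ
  -- A limit of diagonal matrices is diagonal; its entries are the limits of those of `ρ k`.
  set ρbar : Fin n → ℝ := fun i => (Ubar.transpose * G * Vbar) (Fin.castLE hmn i) i with hρbar
  have hρlim : ∀ i, Tendsto (fun k => ρ k i) F (𝓝 (ρbar i)) := fun i => by
    have h1 : Continuous fun A : Mat m n => A (Fin.castLE hmn i) i := by fun_prop
    exact ((h1.tendsto _).comp hlim).congr fun k => by simp [rectDiag]
  refine isLiftedStationary_of_diag hlam hv (mem_activePieces_of_limit hmn hv hX hd) hXbar
    (hft.grad_limit_mem hZ (hrun.mu_mem hsigma.1) hmu hG) (ρ := ρbar)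
    (tendsto_nhds_unique hlim ((continuous_rectDiag.tendsto _).comp (tendsto_pi_nhds.2 hρlim)))
    fun i η => ?_
  have h1 : Tendsto (fun k => ρ k i * η + lam / v * (1 - pieceInd d i)
      * (|sv (X (k + 1)) i + η| - sv (X (k + 1)) i)) F
      (𝓝 (ρbar i * η + lam / v * (1 - pieceInd d i) * (|sv Xbar i + η| - sv Xbar i))) :=
    ((hρlim i).mul_const η).add ((((hsv i).add_const η).abs.sub (hsv i)).const_mul _)
  refine ge_of_tendsto h1 (hd.mono fun k hk => ?_)
  rw [← hk]
  exact hopt k i η
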